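/- Let $\mathcal C$ be the class of multiplicative functions $f:\mathbb N\to\mathbb C$ (with $f(1)=1$) such that $|\Lambda_f(n)|\le\Lambda(n)$ for all $n\ge1$, where $\Lambda$ is the von Mangoldt function and $\Lambda_f$ is given by $-F'(s)/F(s)=\sum_{n}\Lambda_f(n)n^{-s}$ with $F(s)=\sum_n f(n)n^{-s}$, that is, $f(n)\log n=\sum_{de=n}f(d)\Lambda_f(e)$ for all $n\ge 1$. For a Dirichlet character $\chi$ put $S_f(x,\chi)=\sum_{n\le x}f(n)\overline{\chi}(n)$. For a finite set $\Xi$ of primitive Dirichlet characters let $\Xi_q$ be the set of characters mod $q$ induced by characters in $\Xi$, and put $$\Delta_\Xi(f,x;q,a)=\sum_{\substack{n\le x\\ n\equiv a\ (\mathrm{mod}\ q)}}f(n)-\frac1{\varphi(q)}\sum_{\chi\in\Xi_q}\chi(a)S_f(x,\chi).$$ Proposition 1.3. Fix $\varepsilon>0$, $0<\gamma\le\frac12-\varepsilon$ and $B\ge0$. There are constants $C_1,C_2$ and a function $o(x)$ with $o(x)\to0$ as $x\to\infty$, all depending only on $\varepsilon,\gamma,B$, such that the following holds for every real $x\ge3$.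 Put $y=x^\gamma$ and $R=x^{\varepsilon/(3\log\log x)}$, and let $f\in\mathcal C$ be supported on $y$-smooth integers (those all of whose prime factors are $\le y$). Then there is a set $\Xi$ of primitive characters $\psi$ mod $r$, each with $1\le r\le R$, with $$|\Xi|\le C_1(\log x)^{6B+7+o(x)},$$ such that for all integers $1\le q\le R$ and all integers $a$ with $(a,q)=1$, $$|\Delta_\Xi(f,x;q,a)|\le C_2\,\frac1{\varphi(q)}\,\frac{x}{(\log x)^B}.$$ -/

import Mathlib

open Filter Topology

noncomputable section

/-- `L` is the arithmetic function `Λ_f` defined by `-F'(s)/F(s) = ∑ L(n) n^{-s}`, where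
`F(s) = ∑ f(n) n^{-s}`. Comparing the coefficients of `-F' = F * (∑ L(n) n^{-s})`, this says that
`f(n) log n = ∑_{d * e = n} f(d) L(e)` for all `n`; for `f 1 ≠ 0` it determines `L` uniquely. -/
def IsLogDerivCoeff (f L : ArithmeticFunction ℂ) : Prop :=
  ∀ n : ℕ, f n * (Real.log n : ℂ) = (f * L) n

/-- The class `𝒞` of multiplicative functions `f` with `|Λ_f(n)| ≤ Λ(n)` for all `n`. -/
def InClassC (f : ArithmeticFunction ℂ) : Prop :=
  f.IsMultiplicative ∧
    ∃ L : ArithmeticFunction ℂ, IsLogDerivCoeff f L ∧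
      ∀ n : ℕ, ‖L n‖ ≤ ArithmeticFunction.vonMangoldt n

/-- `f` is supported on `y`-smooth integers (all prime factors are `≤ y`). -/
def SupportedOnSmooth (f : ArithmeticFunction ℂ) (y : ℝ) : Prop :=
  ∀ n : ℕ, f n ≠ 0 → ∀ p : ℕ, p.Prime → p ∣ n → (p : ℝ) ≤ y

/-- `S_f(x, χ) = ∑_{n ≤ x} f(n) conj(χ(n))`. -/
def charSum (f : ArithmeticFunction ℂ) (x : ℝ) {q : ℕ} (χ : DirichletCharacter ℂ q) : ℂ :=
  ∑ n ∈ Finset.Icc 1 ⌊x⌋₊, f n * (starRingEnd ℂ) (χ (n : ZMod q))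

/-- A Dirichlet character together with its modulus. -/
abbrev ModChar : Type := Σ r : ℕ, DirichletCharacter ℂ r

open Classical in
/-- `Ξ_q`: the set of characters modulo `q` that are induced by the characters in `Ξ`. -/
def inducedChars (Ξ : Finset ModChar) (q : ℕ) [NeZero q] : Finset (DirichletCharacter ℂ q) :=
  Finset.univ.filter fun χ =>
    ∃ ψ ∈ Ξ, ∃ h : ψ.1 ∣ q, χ = DirichletCharacter.changeLevel h ψ.2

open Classical in
/-- `Δ_Ξ(f, x; q, a) = ∑_{n ≤ x, n ≡ a (mod q)} f(n) - (1/φ(q)) ∑_{χ ∈ Ξ_q} χ(a) S_f(x, χ)`. -/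
def discrepancy (Ξ : Finset ModChar) (f : ArithmeticFunction ℂ) (x : ℝ)
    (q : ℕ) [NeZero q] (a : ℤ) : ℂ :=
  (∑ n ∈ (Finset.Icc 1 ⌊x⌋₊).filter (fun n : ℕ => (n : ℤ) ≡ a [ZMOD q]), f n) -
    (1 / (Nat.totient q : ℂ)) * ∑ χ ∈ inducedChars Ξ q, χ (a : ZMod q) * charSum f x χ

end

/-! Membership in the class enters only through multiplicativity and `|f| ≤ 1`. Write `L = log x`,
`l = log log x`, `R = e^ρ`, and put `z = R³`. The plan is to give `f` a bilinear shape by pulling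
two primes of `(z, y]` out of `n`, and to count as exceptional those characters that correlate with
`f` on the primes of some short interval.

Extraction. If `n` is divisible by `k ≥ 2` primes of `(z, y]`, none of them squared, then `n = p r
m` in `k(k-1)` ordered ways. Weighting each by a quantity depending on `m` alone gives `f(n) =
u(n)`, with `u` a sum over triples (`pairCoeff_eq`). The primes are put in cells `[s, s e^η)`, and
the cutoff `m ≤ x/(pr)` is replaced by one depending on the cells only. The character sum of `u`
then factors as cell sum × cell sum × cofactor sum (`sum_pairCoeff_char_eq`).

The remaining `n` are sparse in every reduced class modulo `q`
(`card_irregularSet_residue_class_le`): they are close to `x`, or divisible by the square of a prime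
above `z`, or at most `ηx`, or have a `z`-smooth divisor of size at least `x^(1/4)`. The last kind
is controlled by Rankin's method. This is where the size of `R` matters: `log x / log z = l/ε` is a
multiple of `log log x`, so smoothness saves any fixed power of `log x`.

Exceptional characters. Duality and periodicity bound the primitive characters with a large sum over
a given cell by `2L/δ²`. There are `O(L/η)` cells, so `|Ξ| ≤ 4L²/(ηδ²)`
(`card_exceptionalChars_le`). For all other characters one cell sum is bounded pointwise and the two
remaining factors by Cauchy–Schwarz and orthogonality modulo `q`, for a total of about `x δ L^(1/2)`
up to powers of `l` (`sum_norm_pairCoeff_char_le`).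

Balance. The bilinear part forces `δ` slightly below `L^(-B-1/2)`. The sparse part, seen through the
characters of `Ξ_q`, costs `η x √|Ξ|` (`totient_mul_norm_discrepancy_le`). With `δ = L^(-B-5/8)` and
`η = L^(-4B-13/4)` both are `O(x L^(-B))`, and `|Ξ| ≤ 4 L^(6B+13/2)`. -/

open Filter Topology

/-! ### Functions in the class `𝒞` are bounded by one -/

/-- Strong induction on the defining recursion: the term with `e = 1` vanishes because `Λ(1) = 0`,
so only smaller arguments of `f` occur, and `∑_{d ∣ n} Λ(d) = log n` cancels the logarithm. -/
theorem InClassC.norm_le_one {f : ArithmeticFunction ℂ} (hf : InClassC f) (n : ℕ) : ‖f n‖ ≤ 1 := by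
  obtain ⟨hmul, Λf, hrec, hbound⟩ := hf
  induction n using Nat.strong_induction_on with
  | _ n ih =>
    rcases Nat.lt_or_ge n 2 with hn | hn
    · interval_cases n
      · simp
      · simp [hmul.map_one]
    have hlog : 0 < Real.log n := Real.log_pos (by exact_mod_cast hn)
    have hL1 : Λf 1 = 0 := by
      have := hbound 1
      simpa using this
    have key : ‖f n‖ * Real.log n ≤ Real.log n := by
      calc ‖f n‖ * Real.log n = ‖f n * (Real.log n : ℂ)‖ := by
            rw [norm_mul, Complex.norm_real, Real.norm_of_nonneg hlog.le]
        _ = ‖∑ d ∈ n.divisorsAntidiagonal, f d.1 * Λf d.2‖ := by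
            rw [hrec n, ArithmeticFunction.mul_apply]
        _ ≤ ∑ d ∈ n.divisorsAntidiagonal, ArithmeticFunction.vonMangoldt d.2 := by
            refine norm_sum_le_of_le _ fun d hd => ?_
            rw [Nat.mem_divisorsAntidiagonal] at hd
            rw [norm_mul]
            by_cases h1 : d.2 = 1
            · simp [h1, hL1]
            · have hlt : d.1 < n := by
                have h2 : d.2 ≠ 0 := by rintro h; simp [h] at hd; exact hd.2 hd.1.symm
                have h3 : d.1 ≠ 0 := by rintro h; simp [h] at hd; exact hd.2 hd.1.symm
                rw [← hd.1]
                exact lt_mul_of_one_lt_right (Nat.pos_of_ne_zero h3) (by omega)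
              calc ‖f d.1‖ * ‖Λf d.2‖ ≤ 1 * ArithmeticFunction.vonMangoldt d.2 := by
                    gcongr
                    · exact ih _ hlt
                    · exact hbound _
                _ = _ := one_mul _
        _ = ∑ d ∈ n.divisors, ArithmeticFunction.vonMangoldt d := by
            exact Nat.sum_divisorsAntidiagonal' (fun _ d => ArithmeticFunction.vonMangoldt d)
        _ = Real.log n := ArithmeticFunction.vonMangoldt_sum
    exact le_of_mul_le_mul_right (by simpa using key) hlog

/-! ### Counting integers in residue classes -/

theorem card_le_of_pairwise_modEq {S : Finset ℕ} {M : ℕ} (hM : 0 < M) {u l : ℝ} (hl : 0 ≤ l)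
    (hS : ∀ n ∈ S, u ≤ n ∧ (n : ℝ) ≤ u + l) (hmod : ∀ m ∈ S, ∀ n ∈ S, m ≡ n [MOD M]) :
    (S.card : ℝ) ≤ l / M + 1 := by
  rcases S.eq_empty_or_nonempty with rfl | hne
  · simp; positivity
  set a := S.min' hne with ha
  have haS : a ∈ S := S.min'_mem hne
  have hcard : S.card ≤ (Finset.range (⌊l / M⌋₊ + 1)).card := by
    refine Finset.card_le_card_of_injOn (fun n => (n - a) / M) ?_ ?_
    · intro n hn
      have hn' : n ∈ S := hn
      have han : a ≤ n := S.min'_le n hn'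
      simp only [Finset.coe_range, Set.mem_Iio]
      rw [Nat.lt_succ_iff, Nat.le_floor_iff (by positivity)]
      refine Nat.cast_div_le.trans ?_
      gcongr
      rw [Nat.cast_sub han]
      linarith [(hS n hn').2, (hS a haS).1]
    · intro m hm n hn hmn
      have hm' : m ∈ S := hm
      have hn' : n ∈ S := hn
      have ham : a ≤ m := S.min'_le m hm'
      have han : a ≤ n := S.min'_le n hn'
      have h1 : M ∣ m - a := (Nat.modEq_iff_dvd' ham).1 (hmod a haS m hm')
      have h2 : M ∣ n - a := (Nat.modEq_iff_dvd' han).1 (hmod a haS n hn')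
      have := (Nat.div_left_inj h1 h2).1 hmn
      omega
  rw [Finset.card_range] at hcard
  calc (S.card : ℝ) ≤ (⌊l / M⌋₊ : ℝ) + 1 := by exact_mod_cast hcard
    _ ≤ _ := by gcongr; exact Nat.floor_le (by positivity)

/-! ### Sums over characters modulo `q` -/

theorem sum_char_mul_conj_char {q : ℕ} [NeZero q] (a b : ZMod q) (hb : IsUnit b) :
    ∑ χ : DirichletCharacter ℂ q, χ a * (starRingEnd ℂ) (χ b) =
      if b = a then (q.totient : ℂ) else 0 := by
  rw [← DirichletCharacter.sum_char_inv_mul_char_eq ℂ hb a]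
  refine Finset.sum_congr rfl fun χ _ => ?_
  rw [mul_comm]
  congr 1
  have h1 : χ b⁻¹ * χ b = 1 := by rw [← map_mul, ZMod.inv_mul_of_unit b hb, map_one]
  have h2 : χ⁻¹ b * χ b = 1 := by
    rw [← MulChar.mul_apply, inv_mul_cancel, MulChar.one_apply hb]
  have h3 : χ b ≠ 0 := fun h => by simp [h] at h1
  rw [starRingEnd_apply, MulChar.star_apply']
  exact mul_right_cancel₀ h3 (h2.trans h1.symm)

/-- A large-sieve type mean value bound for the characters to a single modulus. -/
theorem sum_norm_sq_char_le {q : ℕ} [NeZero q] (S : Finset ℕ) (u : ℕ → ℂ) {W K : ℝ}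
    (hu : ∀ n ∈ S, ‖u n‖ ≤ W)
    (hK : ∀ n ∈ S, IsUnit (n : ZMod q) →
      ((S.filter fun m : ℕ => (m : ZMod q) = n).card : ℝ) ≤ K) (hK0 : 0 ≤ K) :
    ∑ χ : DirichletCharacter ℂ q, ‖∑ n ∈ S, u n * (starRingEnd ℂ) (χ n)‖ ^ 2 ≤
      q.totient * (W ^ 2 * K * S.card) := by
  -- Open the square and sum over `χ` first; orthogonality then leaves only pairs of units with `m ≡
  -- n` modulo `q`.
  have h1 : ((∑ χ : DirichletCharacter ℂ q, ‖∑ n ∈ S, u n * (starRingEnd ℂ) (χ n)‖ ^ 2 : ℝ) : ℂ) =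
      ∑ n ∈ S, ∑ m ∈ S, u n * (starRingEnd ℂ) (u m) *
        (∑ χ : DirichletCharacter ℂ q, χ m * (starRingEnd ℂ) (χ n)) := by
    push_cast
    simp_rw [← Complex.mul_conj', map_sum, Finset.sum_mul_sum, map_mul, Complex.conj_conj,
      Finset.mul_sum]
    rw [Finset.sum_comm]
    refine Finset.sum_congr rfl fun n _ => ?_
    rw [Finset.sum_comm]
    refine Finset.sum_congr rfl fun m _ => Finset.sum_congr rfl fun χ _ => ?_
    ring
  have h2 : ∀ n ∈ S, ‖∑ m ∈ S, u n * (starRingEnd ℂ) (u m) *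
        (∑ χ : DirichletCharacter ℂ q, χ m * (starRingEnd ℂ) (χ n))‖ ≤ q.totient * (W ^ 2 * K) := by
    intro n hn
    have hW : 0 ≤ W := (norm_nonneg _).trans (hu n hn)
    by_cases hun : IsUnit (n : ZMod q)
    · calc _ ≤ ∑ m ∈ S, if (m : ZMod q) = n then W ^ 2 * q.totient else 0 := by
            refine norm_sum_le_of_le _ fun m hm => ?_
            rw [sum_char_mul_conj_char _ _ hun]
            by_cases hmn : (n : ZMod q) = m
            · rw [if_pos hmn, if_pos hmn.symm, norm_mul, norm_mul, RCLike.norm_conj,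
                Complex.norm_natCast, sq]
              gcongr
              · exact hu n hn
              · exact hu m hm
            · rw [if_neg hmn, if_neg (Ne.symm hmn)]; simp
        _ = (S.filter fun m : ℕ => (m : ZMod q) = n).card * (W ^ 2 * q.totient) := by
            rw [← Finset.sum_filter, Finset.sum_const, nsmul_eq_mul]
        _ ≤ K * (W ^ 2 * q.totient) := by gcongr; exact hK n hn hun
        _ = _ := by ring
    · have : ∀ χ : DirichletCharacter ℂ q, χ (n : ZMod q) = 0 := fun χ => χ.map_nonunit hun
      simp only [this, map_zero, mul_zero, Finset.sum_const_zero, norm_zero]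
      positivity
  have h3 : (∑ χ : DirichletCharacter ℂ q, ‖∑ n ∈ S, u n * (starRingEnd ℂ) (χ n)‖ ^ 2 : ℝ) =
      ‖((∑ χ : DirichletCharacter ℂ q, ‖∑ n ∈ S, u n * (starRingEnd ℂ) (χ n)‖ ^ 2 : ℝ) : ℂ)‖ := by
    rw [Complex.norm_real, Real.norm_of_nonneg (by positivity)]
  rw [h3, h1]
  calc _ ≤ ∑ n ∈ S, (q.totient * (W ^ 2 * K) : ℝ) := norm_sum_le_of_le _ h2
    _ = _ := by rw [Finset.sum_const, nsmul_eq_mul]; ring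

/-- The sum of `u` over a reduced residue class, expanded in characters. -/
theorem sum_residue_class_eq {q : ℕ} [NeZero q] (S : Finset ℕ) (u : ℕ → ℂ) (a : ℤ)
    (ha : IsCoprime a (q : ℤ)) :
    (q.totient : ℂ) * ∑ n ∈ S.filter (fun n : ℕ => (n : ℤ) ≡ a [ZMOD q]), u n =
      ∑ χ : DirichletCharacter ℂ q, χ (a : ZMod q) * ∑ n ∈ S, u n * (starRingEnd ℂ) (χ n) := by
  have hau : IsUnit (a : ZMod q) := by
    rw [← ZMod.coe_unitOfIsCoprime a ha]; exact Units.isUnit _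
  simp_rw [Finset.mul_sum]
  rw [Finset.sum_comm, Finset.sum_filter]
  refine Finset.sum_congr rfl fun n _ => ?_
  have hiff : (n : ℤ) ≡ a [ZMOD q] ↔ (n : ZMod q) = (a : ZMod q) := by
    rw [← ZMod.intCast_eq_intCast_iff]; simp
  have : ∑ χ : DirichletCharacter ℂ q, χ (a : ZMod q) * (u n * (starRingEnd ℂ) (χ n)) =
      u n * ∑ χ : DirichletCharacter ℂ q, χ (a : ZMod q) * (starRingEnd ℂ) (χ n) := by
    rw [Finset.mul_sum]; refine Finset.sum_congr rfl fun χ _ => ?_; ring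
  rw [this]
  by_cases hun : IsUnit (n : ZMod q)
  · rw [sum_char_mul_conj_char _ _ hun]
    by_cases h : (n : ZMod q) = (a : ZMod q)
    · rw [if_pos (hiff.2 h), if_pos h]; ring
    · rw [if_neg (fun h' => h (hiff.1 h')), if_neg h]; ring
  · rw [if_neg]
    · simp [fun χ : DirichletCharacter ℂ q => χ.map_nonunit hun]
    · intro h
      rw [hiff] at h
      exact hun (h ▸ hau)

/-! ### Large values of character sums over primitive characters -/

theorem sum_range_char_eq_zero {M : ℕ} [NeZero M] {θ : DirichletCharacter ℂ M} (hθ : θ ≠ 1) :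
    ∑ n ∈ Finset.range M, θ (n : ZMod M) = 0 := by
  rw [← MulChar.sum_eq_zero_of_ne_one hθ]
  refine Finset.sum_bij' (fun n _ => (n : ZMod M)) (fun a _ => a.val) ?_ ?_ ?_ ?_ ?_
  · intro n _; exact Finset.mem_univ _
  · intro a _; exact Finset.mem_range.2 (ZMod.val_lt a)
  · intro n hn; exact ZMod.val_cast_of_lt (Finset.mem_range.1 hn)
  · intro a _; simp
  · intro n _; rfl

theorem norm_sum_range_char_le {M : ℕ} [NeZero M] {θ : DirichletCharacter ℂ M} (hθ : θ ≠ 1)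
    (n : ℕ) : ‖∑ k ∈ Finset.range n, θ (k : ZMod M)‖ ≤ M := by
  induction n using Nat.strong_induction_on with
  | _ n ih =>
    rcases le_or_gt n M with h | h
    · calc _ ≤ ∑ k ∈ Finset.range n, (1 : ℝ) := norm_sum_le_of_le _ fun k _ => θ.norm_le_one _
        _ ≤ M := by simpa using h
    · obtain ⟨m, rfl⟩ := Nat.exists_eq_add_of_lt h
      have hM : 0 < M := Nat.pos_of_ne_zero (NeZero.ne M)
      have := ih (m + 1) (by omega)
      rw [show M + m + 1 = M + (m + 1) by ring, Finset.sum_range_add, sum_range_char_eq_zero hθ,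
        zero_add]
      simpa using this

theorem norm_sum_Ico_char_le {M : ℕ} [NeZero M] {θ : DirichletCharacter ℂ M} (hθ : θ ≠ 1)
    (A l : ℕ) : ‖∑ k ∈ Finset.Ico A (A + l), θ (k : ZMod M)‖ ≤ 2 * M := by
  rw [Finset.sum_Ico_eq_sub _ (Nat.le_add_right _ _)]
  refine (norm_sub_le _ _).trans ?_
  linarith [norm_sum_range_char_le hθ A, norm_sum_range_char_le hθ (A + l)]

theorem changeLevel_natCast_eq {r M : ℕ} (h : r ∣ M) (ψ : DirichletCharacter ℂ r) {n : ℕ}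
    (hn : n.Coprime M) :
    DirichletCharacter.changeLevel h ψ (n : ZMod M) = ψ (n : ZMod r) := by
  have := DirichletCharacter.changeLevel_eq_cast_of_dvd' ψ h (a := (n : ℤ))
    (Nat.isCoprime_iff_coprime.2 hn)
  simpa using this

/-- Inducing does not change the conductor, and the conductor of a primitive character is its
modulus, so the two moduli agree; inducing is also injective. -/
theorem modChar_eq_of_changeLevel_eq {ψ ψ' : ModChar} (hψ : ψ.2.IsPrimitive)
    (hψ' : ψ'.2.IsPrimitive) {M : ℕ} [NeZero M] (h : ψ.1 ∣ M) (h' : ψ'.1 ∣ M)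
    (heq : DirichletCharacter.changeLevel h ψ.2 = DirichletCharacter.changeLevel h' ψ'.2) :
    ψ = ψ' := by
  obtain ⟨r, ψ⟩ := ψ
  obtain ⟨r', ψ'⟩ := ψ'
  have h1 := DirichletCharacter.conductor_changeLevel ψ h
  have h2 := DirichletCharacter.conductor_changeLevel ψ' h'
  have h3 : ψ.conductor = r := hψ
  have h4 : ψ'.conductor = r' := hψ'
  simp only at heq h1 h2
  have : r = r' := by rw [← h3, ← h4, ← h1, ← h2, heq]
  subst this
  rw [DirichletCharacter.changeLevel_injective h heq]

/-- For distinct primitive characters the product is a nonprincipal character modulo the product of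
the moduli, so complete periods cancel. -/
theorem norm_sum_conj_char_mul_char_le {ψ ψ' : ModChar} (hψ : ψ.2.IsPrimitive)
    (hψ' : ψ'.2.IsPrimitive) (hne : ψ ≠ ψ') (h0 : ψ.1 ≠ 0) (h0' : ψ'.1 ≠ 0) (A l : ℕ) :
    ‖∑ n ∈ Finset.Ico A (A + l), (starRingEnd ℂ) (ψ.2 n) * ψ'.2 n‖ ≤ 2 * (ψ.1 * ψ'.1) := by
  have : NeZero (ψ.1 * ψ'.1) := ⟨mul_ne_zero h0 h0'⟩
  have hd : ψ.1 ∣ ψ.1 * ψ'.1 := dvd_mul_right _ _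
  have hd' : ψ'.1 ∣ ψ.1 * ψ'.1 := dvd_mul_left _ _
  set α := DirichletCharacter.changeLevel hd ψ.2 with hα
  set β := DirichletCharacter.changeLevel hd' ψ'.2 with hβ
  have hθ : α⁻¹ * β ≠ 1 := by
    intro h
    exact hne (modChar_eq_of_changeLevel_eq hψ hψ' hd hd' (inv_mul_eq_one.1 h))
  have key : ∀ n : ℕ, (starRingEnd ℂ) (ψ.2 n) * ψ'.2 n = (α⁻¹ * β) (n : ZMod (ψ.1 * ψ'.1)) := by
    intro n
    by_cases hn : n.Coprime (ψ.1 * ψ'.1)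
    · rw [MulChar.mul_apply, ← MulChar.star_apply', hα, hβ, changeLevel_natCast_eq hd _ hn,
        changeLevel_natCast_eq hd' _ hn]
      rfl
    · rw [MulChar.map_nonunit (α⁻¹ * β) (by rwa [ZMod.isUnit_iff_coprime])]
      rw [Nat.coprime_mul_iff_right, not_and_or, ← ZMod.isUnit_iff_coprime,
        ← ZMod.isUnit_iff_coprime] at hn
      rcases hn with hn | hn
      · rw [ψ.2.map_nonunit hn]; simp
      · rw [ψ'.2.map_nonunit hn]; simp
  simp_rw [key]
  have := norm_sum_Ico_char_le hθ A l
  push_cast at this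
  exact this

theorem modChar_norm_le_one (ψ : ModChar) (n : ℕ) : ‖ψ.2 (n : ZMod ψ.1)‖ ≤ 1 :=
  ψ.2.norm_le_one _

/-- A weak form of the large sieve inequality: a bound for the number of primitive characters of
small conductor at which a character sum over a long interval is large. -/
theorem card_mul_sq_le_of_large_values (Ψ : Finset ModChar) {R t : ℝ} (S : Finset ℕ) (u : ℕ → ℂ)
    (A l : ℕ) (hΨ : ∀ ψ ∈ Ψ, ψ.1 ≠ 0 ∧ (ψ.1 : ℝ) ≤ R ∧ ψ.2.IsPrimitive)
    (hu : ∀ n ∈ S, ‖u n‖ ≤ 1) (hS : S ⊆ Finset.Ico A (A + l)) (ht0 : 0 ≤ t)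
    (ht : ∀ ψ ∈ Ψ, t ≤ ‖∑ n ∈ S, u n * (starRingEnd ℂ) (ψ.2 n)‖)
    (hR : 4 * S.card * R ^ 2 ≤ t ^ 2) :
    (Ψ.card : ℝ) * t ^ 2 ≤ 2 * S.card * l := by
  classical
  rcases Ψ.eq_empty_or_nonempty with rfl | hne
  · simp; positivity
  set P : ModChar → ℂ := fun ψ => ∑ n ∈ S, u n * (starRingEnd ℂ) (ψ.2 n) with hP
  -- Duality: twisting by the phases `c ψ` turns the sum of absolute values over `Ψ` into a linear
  -- form in `u`.
  obtain ⟨c, hc1, hcP⟩ : ∃ c : ModChar → ℂ, (∀ ψ, ‖c ψ‖ ≤ 1) ∧ ∀ ψ, c ψ * P ψ = ‖P ψ‖ := by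
    refine ⟨fun ψ => (starRingEnd ℂ) (P ψ) / ‖P ψ‖, fun ψ => ?_, fun ψ => ?_⟩
    · rw [norm_div, RCLike.norm_conj, Complex.norm_real, norm_norm]
      exact div_self_le_one _
    · by_cases h : P ψ = 0
      · simp [h]
      · have : (‖P ψ‖ : ℂ) ≠ 0 := by simpa using h
        field_simp
        rw [Complex.conj_mul']
  set V : ℕ → ℂ := fun n => ∑ ψ ∈ Ψ, c ψ * (starRingEnd ℂ) (ψ.2 n) with hV
  have h1 : (Ψ.card : ℝ) * t ≤ ‖∑ n ∈ S, u n * V n‖ := by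
    have : ∑ n ∈ S, u n * V n = ((∑ ψ ∈ Ψ, ‖P ψ‖ : ℝ) : ℂ) := by
      push_cast
      simp_rw [← hcP, hP, hV, Finset.mul_sum]
      rw [Finset.sum_comm]
      refine Finset.sum_congr rfl fun ψ _ => Finset.sum_congr rfl fun n _ => by ring
    rw [this, Complex.norm_real, Real.norm_of_nonneg (by positivity), ← nsmul_eq_mul]
    exact Finset.card_nsmul_le_sum _ _ _ ht
  -- After Cauchy–Schwarz the coefficients are gone, and positivity allows completion to the whole
  -- interval, where character sums cancel.
  have h2 : ‖∑ n ∈ S, u n * V n‖ ^ 2 ≤ S.card * ∑ n ∈ Finset.Ico A (A + l), ‖V n‖ ^ 2 := by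
    calc ‖∑ n ∈ S, u n * V n‖ ^ 2 ≤ (∑ n ∈ S, ‖V n‖) ^ 2 := by
          gcongr
          refine norm_sum_le_of_le _ fun n hn => ?_
          rw [norm_mul]
          exact mul_le_of_le_one_left (norm_nonneg _) (hu n hn)
      _ ≤ S.card * ∑ n ∈ S, ‖V n‖ ^ 2 := sq_sum_le_card_mul_sum_sq
      _ ≤ _ := by
          gcongr
  have h3 : ∑ n ∈ Finset.Ico A (A + l), ‖V n‖ ^ 2 ≤ Ψ.card * l + Ψ.card ^ 2 * (2 * R ^ 2) := by
    have e1 : ((∑ n ∈ Finset.Ico A (A + l), ‖V n‖ ^ 2 : ℝ) : ℂ) =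
        ∑ ψ ∈ Ψ, ∑ ψ' ∈ Ψ, c ψ * (starRingEnd ℂ) (c ψ') *
          ∑ n ∈ Finset.Ico A (A + l), (starRingEnd ℂ) (ψ.2 n) * ψ'.2 n := by
      push_cast
      simp_rw [← Complex.mul_conj', hV, map_sum, Finset.sum_mul_sum, map_mul, Complex.conj_conj,
        Finset.mul_sum]
      rw [Finset.sum_comm]
      refine Finset.sum_congr rfl fun ψ _ => ?_
      rw [Finset.sum_comm]
      refine Finset.sum_congr rfl fun ψ' _ => Finset.sum_congr rfl fun n _ => ?_
      ring
    have e2 : (∑ n ∈ Finset.Ico A (A + l), ‖V n‖ ^ 2 : ℝ) =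
        ‖((∑ n ∈ Finset.Ico A (A + l), ‖V n‖ ^ 2 : ℝ) : ℂ)‖ := by
      rw [Complex.norm_real, Real.norm_of_nonneg (by positivity)]
    rw [e2, e1]
    calc _ ≤ ∑ ψ ∈ Ψ, ∑ ψ' ∈ Ψ, ((if ψ = ψ' then (l : ℝ) else 0) + 2 * R ^ 2) := by
          refine norm_sum_le_of_le _ fun ψ hψ => norm_sum_le_of_le _ fun ψ' hψ' => ?_
          rw [norm_mul, norm_mul, RCLike.norm_conj]
          have hcc : ‖c ψ‖ * ‖c ψ'‖ ≤ 1 := mul_le_one₀ (hc1 _) (norm_nonneg _) (hc1 _)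
          refine (mul_le_of_le_one_left (norm_nonneg _) hcc).trans ?_
          by_cases h : ψ = ψ'
          · rw [if_pos h]
            calc _ ≤ ∑ n ∈ Finset.Ico A (A + l), (1 : ℝ) := by
                  refine norm_sum_le_of_le _ fun n _ => ?_
                  rw [norm_mul, RCLike.norm_conj]
                  exact mul_le_one₀ (modChar_norm_le_one _ _) (norm_nonneg _)
                    (modChar_norm_le_one _ _)
              _ ≤ l + 2 * R ^ 2 := by simp; positivity
          · rw [if_neg h, zero_add]
            refine (norm_sum_conj_char_mul_char_le (hΨ ψ hψ).2.2 (hΨ ψ' hψ').2.2 h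
              (hΨ ψ hψ).1 (hΨ ψ' hψ').1 A l).trans ?_
            rw [sq]
            have := (hΨ ψ hψ).2.1
            gcongr
            · exact (Nat.cast_nonneg _).trans this
            · exact (hΨ ψ' hψ').2.1
      _ = _ := by
          simp [Finset.sum_add_distrib]
          ring
  have hN : (0 : ℝ) < Ψ.card := by exact_mod_cast hne.card_pos
  have h4 : ((Ψ.card : ℝ) * t) ^ 2 ≤ S.card * (Ψ.card * l + Ψ.card ^ 2 * (2 * R ^ 2)) := by
    calc _ ≤ ‖∑ n ∈ S, u n * V n‖ ^ 2 := by gcongr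
      _ ≤ _ := h2
      _ ≤ _ := by gcongr
  -- By `hR` the off-diagonal terms make up at most half of the left side of `h4` and can be
  -- absorbed.
  have h5 : (Ψ.card : ℝ) ^ 2 * (4 * S.card * R ^ 2) ≤ Ψ.card ^ 2 * t ^ 2 := by gcongr
  refine le_of_mul_le_mul_left ?_ hN
  nlinarith

/-! ### Sums over primes -/

/-- Chebyshev's bound for `θ(2^(j+1))`, divided by the lower end `2^j` of the block. -/
theorem sum_log_prime_dyadic_le (T : Finset ℕ) (hT : ∀ p ∈ T, p.Prime) (j : ℕ)
    (hj : ∀ p ∈ T, Nat.log 2 p = j) : ∑ p ∈ T, Real.log p / p ≤ 4 * Real.log 2 := by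
  have h1 : ∑ p ∈ T, Real.log p ≤ Chebyshev.theta ((2 : ℝ) ^ (j + 1)) := by
    unfold Chebyshev.theta
    refine Finset.sum_le_sum_of_subset_of_nonneg ?_ ?_
    · intro p hp
      have hpp := hT p hp
      rw [Finset.mem_filter, Finset.mem_Ioc]
      refine ⟨⟨hpp.pos, ?_⟩, hpp⟩
      refine Nat.le_floor ?_
      have := Nat.lt_pow_succ_log_self (b := 2) (by norm_num) p
      rw [hj p hp] at this
      exact_mod_cast this.le
    · intro p _ _
      exact Real.log_natCast_nonneg p
  have h2 := Chebyshev.theta_le_log4_mul_x (x := (2 : ℝ) ^ (j + 1)) (by positivity)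
  have h4 : Real.log 4 = 2 * Real.log 2 := by
    rw [show (4 : ℝ) = 2 ^ 2 by norm_num, Real.log_pow]; norm_num
  calc ∑ p ∈ T, Real.log p / p ≤ ∑ p ∈ T, Real.log p / 2 ^ j := by
        refine Finset.sum_le_sum fun p hp => ?_
        have := Nat.pow_log_le_self 2 (hT p hp).ne_zero
        rw [hj p hp] at this
        gcongr
        exact_mod_cast this
    _ = (∑ p ∈ T, Real.log p) / 2 ^ j := by rw [Finset.sum_div]
    _ ≤ (Real.log 4 * 2 ^ (j + 1)) / 2 ^ j := by gcongr; exact h1.trans h2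
    _ = 4 * Real.log 2 := by rw [h4, pow_succ]; field_simp; norm_num

theorem natLog_two_le {z : ℝ} (hz : 1 ≤ z) : (Nat.log 2 ⌊z⌋₊ : ℝ) * Real.log 2 ≤ Real.log z := by
  have h1 : ⌊z⌋₊ ≠ 0 := by
    have := Nat.le_floor (n := 1) (a := z) (by simpa using hz); omega
  have h2 : ((2 : ℝ) ^ Nat.log 2 ⌊z⌋₊) ≤ z := by
    refine le_trans ?_ (Nat.floor_le (by linarith))
    exact_mod_cast Nat.pow_log_le_self 2 h1
  rw [← Real.log_pow]
  exact Real.log_le_log (by positivity) h2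

theorem sum_log_prime_div_le {z : ℝ} (hz : 2 ≤ z) (T : Finset ℕ) (hT : ∀ p ∈ T, p.Prime)
    (hz' : ∀ p ∈ T, (p : ℝ) ≤ z) : ∑ p ∈ T, Real.log p / p ≤ 8 * Real.log z := by
  have hmaps : ∀ p ∈ T, Nat.log 2 p ∈ Finset.range (Nat.log 2 ⌊z⌋₊ + 1) := by
    intro p hp
    rw [Finset.mem_range, Nat.lt_succ_iff]
    exact Nat.log_mono_right (Nat.le_floor (hz' p hp))
  rw [← Finset.sum_fiberwise_of_maps_to hmaps]
  calc _ ≤ ∑ j ∈ Finset.range (Nat.log 2 ⌊z⌋₊ + 1), 4 * Real.log 2 := by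
        refine Finset.sum_le_sum fun j _ => ?_
        refine sum_log_prime_dyadic_le _ (fun p hp => hT p (Finset.mem_filter.1 hp).1) j
          (fun p hp => (Finset.mem_filter.1 hp).2)
    _ = 4 * ((Nat.log 2 ⌊z⌋₊ : ℝ) * Real.log 2 + Real.log 2) := by
        rw [Finset.sum_const, Finset.card_range, nsmul_eq_mul]; push_cast; ring
    _ ≤ 4 * (Real.log z + Real.log z) := by
        gcongr
        exact natLog_two_le (by linarith)
    _ = _ := by ring

/-- In the block `[2^j, 2^(j+1))` one has `log p ≥ j log 2`, so the block contributes at most `4/j`;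
the harmonic sum over `j ≤ 2 log z` gives the double logarithm. -/
theorem sum_prime_inv_le {z : ℝ} (hz : 2 ≤ z) (T : Finset ℕ) (hT : ∀ p ∈ T, p.Prime)
    (hz' : ∀ p ∈ T, (p : ℝ) ≤ z) : ∑ p ∈ T, (1 : ℝ) / p ≤ 4 * Real.log (Real.log z) + 8 := by
  have hl2 : 0 < Real.log 2 := Real.log_pos (by norm_num)
  set J := Nat.log 2 ⌊z⌋₊ with hJ
  have hmaps : ∀ p ∈ T, Nat.log 2 p ∈ Finset.Icc 1 J := by
    intro p hp
    rw [Finset.mem_Icc]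
    exact ⟨Nat.log_pos (by norm_num) (hT p hp).two_le, Nat.log_mono_right (Nat.le_floor (hz' p hp))⟩
  have hJ1 : 1 ≤ J := Nat.log_pos (by norm_num) (Nat.le_floor (by exact_mod_cast hz))
  rw [← Finset.sum_fiberwise_of_maps_to hmaps]
  have hlogJ : Real.log J ≤ Real.log (Real.log z) + 1 := by
    have h1 : (J : ℝ) ≤ Real.log z * 2 := by
      have := natLog_two_le (z := z) (by linarith)
      have h3 : (1 / 2 : ℝ) ≤ Real.log 2 := by linarith [Real.log_two_gt_d9]
      have : (J : ℝ) * (1 / 2) ≤ Real.log z := le_trans (by gcongr) this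
      linarith
    have h2 : 0 < Real.log z := Real.log_pos (by linarith)
    calc Real.log J ≤ Real.log (Real.log z * 2) :=
          Real.log_le_log (by exact_mod_cast hJ1) h1
      _ = Real.log (Real.log z) + Real.log 2 := Real.log_mul h2.ne' (by norm_num)
      _ ≤ _ := by linarith [Real.log_two_lt_d9]
  calc _ ≤ ∑ j ∈ Finset.Icc 1 J, 4 * (j : ℝ)⁻¹ := by
        refine Finset.sum_le_sum fun j hj => ?_
        have hj0 : (0 : ℝ) < j := by exact_mod_cast (Finset.mem_Icc.1 hj).1
        have := sum_log_prime_dyadic_le (T.filter fun p => Nat.log 2 p = j)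
          (fun p hp => hT p (Finset.mem_filter.1 hp).1) j (fun p hp => (Finset.mem_filter.1 hp).2)
        have h2 : (j * Real.log 2) * ∑ p ∈ T.filter (fun p => Nat.log 2 p = j), (1 : ℝ) / p ≤
            ∑ p ∈ T.filter (fun p => Nat.log 2 p = j), Real.log p / p := by
          rw [Finset.mul_sum]
          refine Finset.sum_le_sum fun p hp => ?_
          have hp0 := (hT p (Finset.mem_filter.1 hp).1).ne_zero
          have := Nat.pow_log_le_self 2 hp0
          rw [(Finset.mem_filter.1 hp).2] at this
          have h3 : (j : ℝ) * Real.log 2 ≤ Real.log p := by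
            rw [← Real.log_pow]
            exact Real.log_le_log (by positivity) (by exact_mod_cast this)
          rw [mul_one_div]
          gcongr
        have h3 : (j * Real.log 2) * ∑ p ∈ T.filter (fun p => Nat.log 2 p = j), (1 : ℝ) / p ≤
            (j * Real.log 2) * (4 * (j : ℝ)⁻¹) := by
          refine (h2.trans this).trans (le_of_eq ?_)
          field_simp
        exact le_of_mul_le_mul_left h3 (by positivity)
    _ = 4 * ((harmonic J : ℚ) : ℝ) := by
        rw [harmonic_eq_sum_Icc, ← Finset.mul_sum]; push_cast; rfl
    _ ≤ 4 * (1 + Real.log J) := by gcongr; exact harmonic_le_one_add_log J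
    _ ≤ _ := by linarith

/-! ### Reciprocals of large smooth numbers -/

theorem exp_sub_one_le_mul_exp {v c : ℝ} (hv : 0 ≤ v) (hvc : v ≤ c) :
    Real.exp v ≤ 1 + v * Real.exp c := by
  have h1 : 1 - v ≤ Real.exp (-v) := by linarith [Real.add_one_le_exp (-v)]
  have h2 : Real.exp v * Real.exp (-v) = 1 := by rw [← Real.exp_add]; simp
  have h3 : Real.exp v ≤ Real.exp c := Real.exp_le_exp.2 hvc
  nlinarith [Real.exp_pos v]

/-- With `σ = c / log z` and `p ≤ z` one has `σ log p ≤ c`, hence `p^σ ≤ 1 + σ e^c log p`. The two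
terms are then sums of `1/p` and of `log p / p`. -/
theorem sum_prime_rpow_le {z c : ℝ} (hz : 2 ≤ z) (hc : 0 ≤ c) (T : Finset ℕ)
    (hT : ∀ p ∈ T, p.Prime) (hz' : ∀ p ∈ T, (p : ℝ) ≤ z) :
    ∑ p ∈ T, (p : ℝ) ^ (c / Real.log z - 1) ≤
      4 * Real.log (Real.log z) + 8 + 8 * c * Real.exp c := by
  have hlz : 0 < Real.log z := Real.log_pos (by linarith)
  calc _ ≤ ∑ p ∈ T, ((1 : ℝ) / p + (c * Real.exp c / Real.log z) * (Real.log p / p)) := by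
        refine Finset.sum_le_sum fun p hp => ?_
        have hp0 : (0 : ℝ) < p := by exact_mod_cast (hT p hp).pos
        rw [Real.rpow_sub hp0, Real.rpow_one, Real.rpow_def_of_pos hp0]
        have hl0 : 0 ≤ Real.log p := Real.log_natCast_nonneg p
        have hle : Real.log p ≤ Real.log z := Real.log_le_log hp0 (hz' p hp)
        have h1 := exp_sub_one_le_mul_exp (v := Real.log p * (c / Real.log z)) (c := c)
          (by positivity) (by
            rw [mul_div_assoc', div_le_iff₀ hlz, mul_comm]; gcongr)
        calc _ ≤ (1 + Real.log p * (c / Real.log z) * Real.exp c) / p := by gcongr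
          _ = _ := by field_simp
    _ = ∑ p ∈ T, (1 : ℝ) / p + (c * Real.exp c / Real.log z) * ∑ p ∈ T, Real.log p / p := by
        rw [Finset.sum_add_distrib, Finset.mul_sum]
    _ ≤ (4 * Real.log (Real.log z) + 8) + (c * Real.exp c / Real.log z) * (8 * Real.log z) := by
        gcongr
        · exact sum_prime_inv_le hz T hT hz'
        · exact sum_log_prime_div_le hz T hT hz'
    _ = _ := by field_simp

theorem inv_one_sub_le_exp {t : ℝ} (ht : 0 ≤ t) (ht' : t ≤ 3 / 4) :
    (1 - t)⁻¹ ≤ Real.exp (4 * t) := by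
  have h1 : 0 < 1 - t := by linarith
  rw [inv_le_iff_one_le_mul₀ h1]
  -- `(1 - t)(1 + 4t) = 1 + t(3 - 4t) ≥ 1`, which is why `t ≤ 3/4` is needed.
  nlinarith [Real.add_one_le_exp (4 * t)]

/-- Rankin's bound for the sum of reciprocals of the `z`-smooth numbers beyond `D`. -/
theorem sum_inv_smooth_le {z c D : ℝ} (hz : 2 ≤ z) (hc : 0 ≤ c) (hD : 0 < D)
    (hcz : c / Real.log z ≤ 1 / 2) (T : Finset ℕ)
    (hT : ∀ d ∈ T, D ≤ d ∧ ∀ p : ℕ, p.Prime → p ∣ d → (p : ℝ) ≤ z) :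
    ∑ d ∈ T, (1 : ℝ) / d ≤ D ^ (-(c / Real.log z)) *
      Real.exp (4 * (4 * Real.log (Real.log z) + 8 + 8 * c * Real.exp c)) := by
  set σ := c / Real.log z with hσ
  have hlz : 0 < Real.log z := Real.log_pos (by linarith)
  have hσ0 : 0 ≤ σ := by positivity
  let g : ℕ →* ℝ :=
    { toFun := fun n => (n : ℝ) ^ (σ - 1)
      map_one' := by simp
      map_mul' := fun m n => by
        push_cast; rw [Real.mul_rpow (Nat.cast_nonneg _) (Nat.cast_nonneg _)] }
  have hg : ∀ n : ℕ, g n = (n : ℝ) ^ (σ - 1) := fun _ => rfl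
  have hgp : ∀ {p : ℕ}, p.Prime → 0 ≤ g p ∧ g p ≤ 3 / 4 := by
    intro p hp
    rw [hg]
    refine ⟨by positivity, ?_⟩
    -- As `σ ≤ 1/2` and `p ≥ 2`, the Euler factor has `g p ≤ 2^(-1/2) ≤ 3/4`, the range of
    -- `inv_one_sub_le_exp`.
    have h2 : (2 : ℝ) ≤ p := by exact_mod_cast hp.two_le
    calc (p : ℝ) ^ (σ - 1) ≤ (2 : ℝ) ^ (σ - 1) :=
          Real.rpow_le_rpow_of_nonpos (by norm_num) h2 (by linarith)
      _ ≤ (2 : ℝ) ^ (-(1 / 2) : ℝ) :=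
          Real.rpow_le_rpow_of_exponent_le (by norm_num) (by linarith)
      _ ≤ 3 / 4 := by
          rw [Real.rpow_neg (by norm_num), ← Real.sqrt_eq_rpow, inv_le_comm₀ (by positivity)
            (by norm_num)]
          exact Real.le_sqrt_of_sq_le (by norm_num)
  obtain ⟨hsum, hprod⟩ := EulerProduct.summable_and_hasSum_smoothNumbers_prod_primesBelow_geometric
    (f := g) (fun {p} hp => by
      rw [Real.norm_of_nonneg (hgp hp).1]; linarith [(hgp hp).2]) (⌊z⌋₊ + 1)
  have hmem : ∀ d ∈ T, d ∈ (⌊z⌋₊ + 1).smoothNumbers := by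
    intro d hd
    have hd0 : d ≠ 0 := by
      rintro rfl
      have := (hT 0 hd).1
      simp at this; linarith
    rw [Nat.mem_smoothNumbers]
    refine ⟨hd0, fun p hp => ?_⟩
    rw [Nat.mem_primeFactorsList hd0] at hp
    exact Nat.lt_succ_of_le (Nat.le_floor ((hT d hd).2 p hp.1 hp.2))
  have h1 : ∑ d ∈ T, g d ≤ ∏ p ∈ (⌊z⌋₊ + 1).primesBelow, (1 - g p)⁻¹ := by
    have : ∑ d ∈ T, g d = ∑ d ∈ T.attach.map ⟨fun d => (⟨d.1, hmem d.1 d.2⟩ :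
        (⌊z⌋₊ + 1).smoothNumbers), fun a b h => by
          simp only [Subtype.mk.injEq] at h; exact Subtype.ext h⟩, g d := by
      rw [Finset.sum_map]
      exact (Finset.sum_attach T fun d => g d).symm
    rw [this]
    exact sum_le_hasSum _ (fun d _ => by rw [hg]; positivity) hprod
  have h2 : ∏ p ∈ (⌊z⌋₊ + 1).primesBelow, (1 - g p)⁻¹ ≤
      Real.exp (4 * (4 * Real.log (Real.log z) + 8 + 8 * c * Real.exp c)) := by
    have hpr : ∀ p ∈ (⌊z⌋₊ + 1).primesBelow, p.Prime := fun p hp => Nat.prime_of_mem_primesBelow hp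
    calc _ ≤ ∏ p ∈ (⌊z⌋₊ + 1).primesBelow, Real.exp (4 * g p) := by
          refine Finset.prod_le_prod (fun p hp => ?_) (fun p hp => ?_)
          · exact inv_nonneg.2 (by linarith [(hgp (hpr p hp)).2])
          · exact inv_one_sub_le_exp (hgp (hpr p hp)).1 (hgp (hpr p hp)).2
      _ = Real.exp (4 * ∑ p ∈ (⌊z⌋₊ + 1).primesBelow, g p) := by
          rw [← Real.exp_sum, Finset.mul_sum]
      _ ≤ _ := by
          gcongr
          refine sum_prime_rpow_le hz hc _ hpr fun p hp => ?_
          have := Nat.lt_of_mem_primesBelow hp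
          exact (Nat.le_floor_iff (by linarith)).1 (Nat.lt_succ_iff.1 this)
  -- Rankin's trick: `1 ≤ (d/D)^σ` for `d ≥ D`.
  calc ∑ d ∈ T, (1 : ℝ) / d ≤ ∑ d ∈ T, D ^ (-σ) * g d := by
        refine Finset.sum_le_sum fun d hd => ?_
        have hd1 := (hT d hd).1
        have hd0 : (0 : ℝ) < d := by linarith
        rw [hg, Real.rpow_sub hd0, Real.rpow_one, Real.rpow_neg hD.le, ← mul_div_assoc]
        gcongr
        rw [inv_mul_eq_div, one_le_div (by positivity)]
        gcongr
    _ = D ^ (-σ) * ∑ d ∈ T, g d := by rw [Finset.mul_sum]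
    _ ≤ _ := by gcongr; exact h1.trans h2

/-! ### Extracting two prime factors -/

/-- The number of elements of `P` dividing `n`. -/
def divCount (P : Finset ℕ) (n : ℕ) : ℕ := (P.filter (· ∣ n)).card

/-- The reciprocal of the number of ordered pairs of distinct elements that a number with
`divCount P m + 2` divisors in `P` has. -/
noncomputable def pairWeight (P : Finset ℕ) (m : ℕ) : ℝ :=
  1 / (((divCount P m : ℝ) + 1) * ((divCount P m : ℝ) + 2))

/-- The coefficients of the part of `∑ f(n) n^{-s}` obtained by extracting two prime factors from
`P`, the cofactor being bounded by `X`. -/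
noncomputable def pairCoeff (f : ArithmeticFunction ℂ) (P : Finset ℕ) (X : ℕ → ℕ → ℝ) (n : ℕ) :
    ℂ :=
  ∑ p ∈ P, ∑ r ∈ P, if p * r ∣ n ∧ ((n / (p * r) : ℕ) : ℝ) ≤ X p r then
    f p * f r * (f (n / (p * r)) * pairWeight P (n / (p * r))) else 0

theorem pairWeight_nonneg (P : Finset ℕ) (m : ℕ) : 0 ≤ pairWeight P m := by
  unfold pairWeight; positivity

theorem pairWeight_le_one (P : Finset ℕ) (m : ℕ) : pairWeight P m ≤ 1 := by
  unfold pairWeight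
  rw [div_le_one (by positivity)]
  nlinarith [(Nat.cast_nonneg (divCount P m) : (0 : ℝ) ≤ _)]

theorem divCount_le_add_two {P : Finset ℕ} (hP : ∀ p ∈ P, p.Prime) {p r n : ℕ} (hp : p ∈ P)
    (hr : r ∈ P) (hd : p * r ∣ n) : divCount P n ≤ divCount P (n / (p * r)) + 2 := by
  have hsub : P.filter (· ∣ n) ⊆ P.filter (· ∣ n / (p * r)) ∪ {p, r} := by
    intro s hs
    rw [Finset.mem_filter] at hs
    have hsp := hP s hs.1
    obtain ⟨m, rfl⟩ := hd
    have hpos : 0 < p * r := Nat.mul_pos (hP p hp).pos (hP r hr).pos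
    rw [Nat.mul_div_cancel_left m hpos]
    rcases hsp.dvd_mul.1 hs.2 with h | h
    · rcases hsp.dvd_mul.1 h with h | h
      · simp [(Nat.prime_dvd_prime_iff_eq hsp (hP p hp)).1 h]
      · simp [(Nat.prime_dvd_prime_iff_eq hsp (hP r hr)).1 h]
    · simp [hs.1, h]
  calc divCount P n ≤ _ := Finset.card_le_card hsub
    _ ≤ _ := Finset.card_union_le _ _
    _ ≤ divCount P (n / (p * r)) + 2 := by
        gcongr
        · exact le_rfl
        · exact Finset.card_le_two

/-- At most `k²` ordered pairs contribute, and each cofactor retains at least `k - 2` primes of `P`,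
so each weight is at most `1/((k-1)k)` and the total at most `k/(k-1) ≤ 2`. -/
theorem norm_pairCoeff_le {f : ArithmeticFunction ℂ} (hf : ∀ n, ‖f n‖ ≤ 1) {P : Finset ℕ}
    (hP : ∀ p ∈ P, p.Prime) (X : ℕ → ℕ → ℝ) (n : ℕ) : ‖pairCoeff f P X n‖ ≤ 2 := by
  -- For `k = 1` only `p = r` can occur and `pairWeight` is at most `1/2`; for `k = 0` there are no
  -- terms and the quotient defining `w` is `0`.
  set k := divCount P n with hk
  set w : ℝ := if k = 1 then 1 / 2 else 1 / ((k - 1) * k) with hw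
  have hw0 : 0 ≤ w := by
    rw [hw]; split_ifs with h
    · norm_num
    · rcases Nat.eq_zero_or_pos k with h0 | h0
      · simp [h0]
      · have : (1 : ℝ) ≤ k := by exact_mod_cast h0
        exact div_nonneg zero_le_one (mul_nonneg (by linarith) (by linarith))
  have hterm : ∀ p ∈ P.filter (· ∣ n), ∀ r ∈ P.filter (· ∣ n),
      ‖if p * r ∣ n ∧ ((n / (p * r) : ℕ) : ℝ) ≤ X p r then
        f p * f r * (f (n / (p * r)) * (pairWeight P (n / (p * r)) : ℂ)) else 0‖ ≤ w := by
    intro p hp r hr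
    rw [Finset.mem_filter] at hp hr
    split_ifs with h
    · have hle := divCount_le_add_two hP hp.1 hr.1 h.1
      have h1 : ‖f p * f r * (f (n / (p * r)) * (pairWeight P (n / (p * r)) : ℂ))‖ ≤
          pairWeight P (n / (p * r)) := by
        rw [norm_mul, norm_mul, norm_mul, Complex.norm_real,
          Real.norm_of_nonneg (pairWeight_nonneg _ _)]
        have h2 : ‖f p‖ * ‖f r‖ ≤ 1 := mul_le_one₀ (hf _) (norm_nonneg _) (hf _)
        have h3 : ‖f (n / (p * r))‖ * pairWeight P (n / (p * r)) ≤ pairWeight P (n / (p * r)) :=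
          mul_le_of_le_one_left (pairWeight_nonneg _ _) (hf _)
        exact (mul_le_of_le_one_left
          (mul_nonneg (norm_nonneg _) (pairWeight_nonneg _ _)) h2).trans h3
      refine h1.trans ?_
      have hkpos : 0 < k := Finset.card_pos.2 ⟨p, Finset.mem_filter.2 hp⟩
      rw [hw]
      unfold pairWeight
      split_ifs with hk1
      · gcongr
        nlinarith [(Nat.cast_nonneg (divCount P (n / (p * r))) : (0 : ℝ) ≤ _)]
      · have hk2 : (2 : ℝ) ≤ k := by exact_mod_cast (by omega : 2 ≤ k)
        have hle' : (k : ℝ) ≤ divCount P (n / (p * r)) + 2 := by exact_mod_cast hle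
        gcongr
        · nlinarith
        · linarith
    · simpa using hw0
  have hrestrict : pairCoeff f P X n = ∑ p ∈ P.filter (· ∣ n), ∑ r ∈ P.filter (· ∣ n),
      if p * r ∣ n ∧ ((n / (p * r) : ℕ) : ℝ) ≤ X p r then
        f p * f r * (f (n / (p * r)) * (pairWeight P (n / (p * r)) : ℂ)) else 0 := by
    unfold pairCoeff
    rw [Finset.sum_filter]
    refine Finset.sum_congr rfl fun p _ => ?_
    rw [Finset.sum_filter]
    split_ifs with h
    · refine Finset.sum_congr rfl fun r _ => ?_
      split_ifs with h1 h2 h2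
      · rfl
      · exact absurd ((dvd_mul_left r p).trans h1.1) h2
      · rfl
      · rfl
    · refine Finset.sum_eq_zero fun r _ => ?_
      rw [if_neg]
      exact fun h1 => h ((dvd_mul_right p r).trans h1.1)
  rw [hrestrict]
  calc _ ≤ ∑ p ∈ P.filter (· ∣ n), ∑ r ∈ P.filter (· ∣ n), w :=
        norm_sum_le_of_le _ fun p hp => norm_sum_le_of_le _ fun r hr => hterm p hp r hr
    _ = (k : ℝ) * (k * w) := by
        rw [Finset.sum_const, Finset.sum_const, nsmul_eq_mul, nsmul_eq_mul]; rfl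
    _ ≤ 2 := by
        rw [hw]
        split_ifs with hk1
        · rw [hk1]; norm_num
        · rcases Nat.eq_zero_or_pos k with h0 | h0
          · simp [h0]
          · have hk2 : (2 : ℝ) ≤ k := by exact_mod_cast (by omega : 2 ≤ k)
            have h3 : (0 : ℝ) < k - 1 := by linarith
            rw [mul_one_div, mul_div_assoc', div_le_iff₀ (by positivity)]
            nlinarith

theorem pairCoeff_eq_zero {f : ArithmeticFunction ℂ} {P : Finset ℕ} {X : ℕ → ℕ → ℝ} {n : ℕ}
    (hsq : ∀ p ∈ P, ¬ p * p ∣ n) (hk : divCount P n ≤ 1) : pairCoeff f P X n = 0 := by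
  unfold pairCoeff
  refine Finset.sum_eq_zero fun p hp => Finset.sum_eq_zero fun r hr => if_neg fun h => ?_
  by_cases hpr : p = r
  · subst hpr; exact hsq p hp h.1
  · have : ({p, r} : Finset ℕ) ⊆ P.filter (· ∣ n) := by
      intro s hs
      rw [Finset.mem_insert, Finset.mem_singleton] at hs
      rw [Finset.mem_filter]
      rcases hs with rfl | rfl
      · exact ⟨hp, (dvd_mul_right _ _).trans h.1⟩
      · exact ⟨hr, (dvd_mul_left _ _).trans h.1⟩
    have := Finset.card_le_card this
    rw [Finset.card_pair hpr] at this
    unfold divCount at hk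
    omega

/-- Since no `p²` divides `n`, the admissible pairs are the `k(k-1)` ordered pairs of distinct
primes. The cofactor is coprime to `p r` and has exactly `k - 2` primes of `P`, so every term equals
`f(n)/((k-1)k)`. -/
theorem pairCoeff_eq {f : ArithmeticFunction ℂ} (hf : f.IsMultiplicative) {P : Finset ℕ}
    (hP : ∀ p ∈ P, p.Prime) {X : ℕ → ℕ → ℝ} {n : ℕ}
    (hsq : ∀ p ∈ P, ¬ p * p ∣ n) (hk : 2 ≤ divCount P n)
    (hX : ∀ p ∈ P, ∀ r ∈ P, p * r ∣ n → ((n / (p * r) : ℕ) : ℝ) ≤ X p r) :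
    pairCoeff f P X n = f n := by
  classical
  set D := P.filter (· ∣ n) with hD
  set k := divCount P n with hkdef
  have hDk : D.card = k := rfl
  have hterm : ∀ p ∈ P, ∀ r ∈ P, (if p * r ∣ n ∧ ((n / (p * r) : ℕ) : ℝ) ≤ X p r then
      f p * f r * (f (n / (p * r)) * (pairWeight P (n / (p * r)) : ℂ)) else 0) =
      if (p ∈ D ∧ r ∈ D) ∧ p ≠ r then f n * ((1 / ((k - 1) * k) : ℝ) : ℂ) else 0 := by
    intro p hp r hr
    by_cases hd : p * r ∣ n
    · have hpr : p ≠ r := by rintro rfl; exact hsq p hp hd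
      have hpn : p ∣ n := (dvd_mul_right _ _).trans hd
      have hrn : r ∣ n := (dvd_mul_left _ _).trans hd
      have hpD : p ∈ D := Finset.mem_filter.2 ⟨hp, hpn⟩
      have hrD : r ∈ D := Finset.mem_filter.2 ⟨hr, hrn⟩
      rw [if_pos ⟨hd, hX p hp r hr hd⟩, if_pos ⟨⟨hpD, hrD⟩, hpr⟩]
      obtain ⟨m, hm⟩ := hd
      have hpos : 0 < p * r := Nat.mul_pos (hP p hp).pos (hP r hr).pos
      have hnm : n / (p * r) = m := by rw [hm, Nat.mul_div_cancel_left m hpos]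
      rw [hnm]
      have hpm : ¬ p ∣ m := by
        rintro ⟨c, rfl⟩
        exact hsq p hp ⟨r * c, by rw [hm]; ring⟩
      have hrm : ¬ r ∣ m := by
        rintro ⟨c, rfl⟩
        exact hsq r hr ⟨p * c, by rw [hm]; ring⟩
      have hc1 : Nat.Coprime p r := (Nat.coprime_primes (hP p hp) (hP r hr)).2 hpr
      have hc2 : Nat.Coprime (p * r) m :=
        Nat.Coprime.mul_left (((hP p hp).coprime_iff_not_dvd).2 hpm)
          (((hP r hr).coprime_iff_not_dvd).2 hrm)
      have hcount : divCount P m = k - 2 := by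
        have : P.filter (· ∣ m) = (D.erase p).erase r := by
          ext s
          simp only [Finset.mem_erase, hD, Finset.mem_filter]
          constructor
          · rintro ⟨hs, hsm⟩
            refine ⟨?_, ?_, hs, hsm.trans ⟨p * r, by rw [hm]; ring⟩⟩
            · rintro rfl; exact hrm hsm
            · rintro rfl; exact hpm hsm
          · rintro ⟨h1, h2, hs, hsn⟩
            refine ⟨hs, ?_⟩
            have hsp := hP s hs
            rw [hm] at hsn
            rcases hsp.dvd_mul.1 hsn with h | h
            · rcases hsp.dvd_mul.1 h with h | h
              · exact absurd ((Nat.prime_dvd_prime_iff_eq hsp (hP p hp)).1 h) h2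
              · exact absurd ((Nat.prime_dvd_prime_iff_eq hsp (hP r hr)).1 h) h1
            · exact h
        unfold divCount
        rw [this, Finset.card_erase_of_mem (Finset.mem_erase.2 ⟨hpr.symm, hrD⟩),
          Finset.card_erase_of_mem hpD, hDk]
        rfl
      have hw : pairWeight P m = 1 / ((k - 1) * k) := by
        unfold pairWeight
        rw [hcount, Nat.cast_sub hk]
        push_cast
        congr 1
        ring
      rw [hw]
      have : f n = f p * f r * f m := by
        rw [hm, hf.map_mul_of_coprime hc2, hf.map_mul_of_coprime hc1]
      rw [this]; ring
    · rw [if_neg (fun h => hd h.1), if_neg]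
      rintro ⟨⟨hpD, hrD⟩, hpr⟩
      refine hd (Nat.Coprime.mul_dvd_of_dvd_of_dvd ?_ (Finset.mem_filter.1 hpD).2
        (Finset.mem_filter.1 hrD).2)
      exact (Nat.coprime_primes (hP p hp) (hP r hr)).2 hpr
  have hsum : pairCoeff f P X n = ∑ p ∈ D, ∑ r ∈ D.erase p, f n * ((1 / ((k - 1) * k) : ℝ) : ℂ) := by
    unfold pairCoeff
    rw [Finset.sum_congr rfl fun p hp => Finset.sum_congr rfl fun r hr => hterm p hp r hr]
    rw [← Finset.sum_subset (Finset.filter_subset (· ∣ n) P)]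
    · refine Finset.sum_congr rfl fun p hp => ?_
      have hsub : D.erase p ⊆ P := (Finset.erase_subset _ _).trans (Finset.filter_subset _ _)
      rw [← Finset.sum_subset hsub]
      · refine Finset.sum_congr rfl fun r hr => ?_
        rw [Finset.mem_erase] at hr
        rw [if_pos ⟨⟨hp, hr.2⟩, hr.1.symm⟩]
      · intro r _ hr
        rw [if_neg]
        rintro ⟨⟨_, h⟩, h'⟩
        exact hr (Finset.mem_erase.2 ⟨h'.symm, h⟩)
    · intro p _ hp
      refine Finset.sum_eq_zero fun r _ => if_neg ?_
      rintro ⟨⟨h, _⟩, _⟩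
      exact hp h
  rw [hsum]
  have hk2 : (2 : ℝ) ≤ k := by exact_mod_cast hk
  calc _ = ∑ p ∈ D, ((k - 1 : ℝ) : ℂ) * (f n * ((1 / ((k - 1) * k) : ℝ) : ℂ)) := by
        refine Finset.sum_congr rfl fun p hp => ?_
        rw [Finset.sum_const, Finset.card_erase_of_mem hp, hDk, nsmul_eq_mul,
          Nat.cast_sub (by omega)]
        push_cast; rfl
    _ = f n * (((k : ℝ) * ((k - 1 : ℝ) * (1 / ((k - 1) * k))) : ℝ) : ℂ) := by
        rw [Finset.sum_const, hDk, nsmul_eq_mul]; push_cast; ring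
    _ = f n := by
        have : (k : ℝ) * ((k - 1 : ℝ) * (1 / ((k - 1) * k))) = 1 := by
          have h3 : (k : ℝ) - 1 ≠ 0 := by linarith
          have h4 : (k : ℝ) ≠ 0 := by linarith
          field_simp
        rw [this]; simp

/-- Substitution `n = p r m`; the bound `p r X ≤ x` makes the condition `n ≤ x` automatic. -/
theorem sum_pairCoeff_mul (f : ArithmeticFunction ℂ) {P : Finset ℕ} (hP : ∀ p ∈ P, p.Prime)
    {X : ℕ → ℕ → ℝ} {x : ℝ} (hX : ∀ p ∈ P, ∀ r ∈ P, p * r * X p r ≤ x)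
    (hX0 : ∀ p ∈ P, ∀ r ∈ P, 0 ≤ X p r) (h : ℕ → ℂ) :
    ∑ n ∈ Finset.Icc 1 ⌊x⌋₊, pairCoeff f P X n * h n =
      ∑ p ∈ P, ∑ r ∈ P, f p * f r *
        ∑ m ∈ Finset.Icc 1 ⌊X p r⌋₊, f m * pairWeight P m * h (p * r * m) := by
  unfold pairCoeff
  simp_rw [Finset.sum_mul]
  rw [Finset.sum_comm]
  refine Finset.sum_congr rfl fun p hp => ?_
  rw [Finset.sum_comm]
  refine Finset.sum_congr rfl fun r hr => ?_
  have hpos : 0 < p * r := Nat.mul_pos (hP p hp).pos (hP r hr).pos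
  rw [Finset.mul_sum]
  simp_rw [ite_mul, zero_mul]
  rw [← Finset.sum_filter]
  refine Finset.sum_bij' (fun n _ => n / (p * r)) (fun m _ => p * r * m) ?_ ?_ ?_ ?_ ?_
  · intro n hn
    rw [Finset.mem_filter, Finset.mem_Icc] at hn
    rw [Finset.mem_Icc]
    refine ⟨Nat.div_pos (Nat.le_of_dvd hn.1.1 hn.2.1) hpos, Nat.le_floor hn.2.2⟩
  · intro m hm
    rw [Finset.mem_Icc] at hm
    have hmX : (m : ℝ) ≤ X p r := (Nat.le_floor_iff (hX0 p hp r hr)).1 hm.2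
    rw [Finset.mem_filter, Finset.mem_Icc, Nat.mul_div_cancel_left m hpos]
    refine ⟨⟨Nat.mul_pos hpos hm.1, Nat.le_floor ?_⟩, dvd_mul_right _ _, hmX⟩
    refine le_trans ?_ (hX p hp r hr)
    push_cast
    gcongr
  · intro n hn
    rw [Finset.mem_filter] at hn
    exact Nat.mul_div_cancel' hn.2.1
  · intro m _
    exact Nat.mul_div_cancel_left m hpos
  · intro n hn
    rw [Finset.mem_filter] at hn
    simp only [Nat.mul_div_cancel' hn.2.1]
    ring

/-! ### Sparse sets of integers in residue classes -/

theorem card_residue_class_le {q : ℕ} [NeZero q] (S : Finset ℕ) {u l : ℝ} (hl : 0 ≤ l)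
    (hS : ∀ n ∈ S, u ≤ n ∧ (n : ℝ) ≤ u + l) (c : ZMod q) :
    ((S.filter fun m : ℕ => (m : ZMod q) = c).card : ℝ) ≤ l / q + 1 := by
  refine card_le_of_pairwise_modEq (Nat.pos_of_ne_zero (NeZero.ne q)) hl
    (fun n hn => hS n (Finset.mem_filter.1 hn).1) fun m hm n hn => ?_
  rw [← ZMod.natCast_eq_natCast_iff, (Finset.mem_filter.1 hm).2, (Finset.mem_filter.1 hn).2]

/-- A multiple of `d` in a reduced class forces `d` to be coprime to `q`, so by the Chinese
remainder theorem a single class modulo `d q` remains. -/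
theorem card_multiples_residue_class_le {q : ℕ} [NeZero q] {c : ZMod q} (hc : IsUnit c) {x : ℝ}
    (hx : 0 ≤ x) {d : ℕ} (hd : 0 < d) (S : Finset ℕ)
    (hS : ∀ n ∈ S, (n : ℝ) ≤ x ∧ (n : ZMod q) = c ∧ d ∣ n) :
    (S.card : ℝ) ≤ x / (d * q) + 1 := by
  rcases S.eq_empty_or_nonempty with rfl | ⟨n₀, hn₀⟩
  · simp; positivity
  have hcop : d.Coprime q := by
    have h1 : n₀.Coprime q := by
      rw [← ZMod.isUnit_iff_coprime, (hS n₀ hn₀).2.1]; exact hc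
    exact h1.coprime_dvd_left (hS n₀ hn₀).2.2
  have := card_le_of_pairwise_modEq (S := S) (M := d * q) (u := 0) (l := x)
    (Nat.mul_pos hd (Nat.pos_of_ne_zero (NeZero.ne q))) hx
    (fun n hn => ⟨Nat.cast_nonneg _, by simpa using (hS n hn).1⟩) (fun m hm n hn => by
      rw [← Nat.modEq_and_modEq_iff_modEq_mul hcop]
      constructor
      · exact ((Nat.modEq_zero_iff_dvd).2 (hS m hm).2.2).trans
          ((Nat.modEq_zero_iff_dvd).2 (hS n hn).2.2).symm
      · rw [← ZMod.natCast_eq_natCast_iff, (hS m hm).2.1, (hS n hn).2.1])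
  simpa using this

/-- Remove primes one at a time: each removal divides by at most `z`, so the interval `[D, Dz]`
cannot be jumped over. -/
theorem exists_dvd_mem_interval {z D : ℝ} (hz : 1 ≤ z) (hD : 1 ≤ D) (s : ℕ)
    (hs : ∀ p : ℕ, p.Prime → p ∣ s → (p : ℝ) ≤ z) (hDs : D ≤ s) :
    ∃ d : ℕ, d ∣ s ∧ D ≤ d ∧ (d : ℝ) ≤ D * z := by
  induction s using Nat.strong_induction_on with
  | _ s ih =>
    rcases le_or_gt (s : ℝ) (D * z) with h | h
    · exact ⟨s, dvd_rfl, hDs, h⟩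
    · have hs1 : (1 : ℝ) < s := by nlinarith
      have hs1' : 1 < s := by exact_mod_cast hs1
      obtain ⟨p, hp, m, rfl⟩ := Nat.exists_prime_and_dvd hs1'.ne'
      have hpz := hs p hp (dvd_mul_right _ _)
      have hm0 : 0 < m := by
        rcases Nat.eq_zero_or_pos m with rfl | h0
        · simp at hs1'
        · exact h0
      have hDm : D ≤ m := by
        push_cast at h
        have hm0' : (0 : ℝ) < m := by exact_mod_cast hm0
        have : (p : ℝ) * m ≤ z * m := by gcongr
        have : D * z < m * z := by linarith
        exact (lt_of_mul_lt_mul_right this (by linarith)).le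
      obtain ⟨d, hd, h1, h2⟩ := ih m (lt_mul_of_one_lt_left hm0 hp.one_lt)
        (fun r hr hrm => hs r hr (hrm.trans (dvd_mul_left _ _))) hDm
      exact ⟨d, hd.trans (dvd_mul_left _ _), h1, h2⟩

/-- The primes in the interval `(z, y]`. -/
noncomputable def primesIoc (z y : ℝ) : Finset ℕ := by
  classical exact (Finset.Icc 1 ⌊y⌋₊).filter fun p => p.Prime ∧ z < p

theorem mem_primesIoc {z y : ℝ} {p : ℕ} :
    p ∈ primesIoc z y ↔ p.Prime ∧ z < p ∧ (p : ℝ) ≤ y := by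
  classical
  unfold primesIoc
  rw [Finset.mem_filter, Finset.mem_Icc]
  constructor
  · rintro ⟨⟨h1, h2⟩, h3, h4⟩
    exact ⟨h3, h4, (Nat.le_floor_iff' (by omega)).1 h2⟩
  · rintro ⟨h3, h4, h5⟩
    exact ⟨⟨h3.pos, Nat.le_floor h5⟩, h3, h4⟩

theorem card_primesIoc_le {z y : ℝ} (hy : 0 ≤ y) : ((primesIoc z y).card : ℝ) ≤ y := by
  classical
  unfold primesIoc
  refine le_trans ?_ (Nat.floor_le hy)
  have := Finset.card_filter_le (Finset.Icc 1 ⌊y⌋₊) fun p : ℕ => p.Prime ∧ z < p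
  rw [Nat.card_Icc, Nat.add_sub_cancel] at this
  exact_mod_cast this

theorem sum_primesIoc_inv_sq_le {z y : ℝ} (hz : 0 < z) :
    ∑ p ∈ primesIoc z y, (1 : ℝ) / (p ^ 2) ≤ 2 / z := by
  have hsub : primesIoc z y ⊆ Finset.Ioo ⌊z⌋₊ (⌊y⌋₊ + 1) := by
    intro p hp
    rw [mem_primesIoc] at hp
    rw [Finset.mem_Ioo, Nat.lt_succ_iff]
    exact ⟨(Nat.floor_lt hz.le).2 hp.2.1, Nat.le_floor hp.2.2⟩
  calc _ ≤ ∑ p ∈ Finset.Ioo ⌊z⌋₊ (⌊y⌋₊ + 1), ((p : ℝ) ^ 2)⁻¹ := by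
        simp_rw [one_div]
        exact Finset.sum_le_sum_of_subset_of_nonneg hsub fun _ _ _ => by positivity
    _ ≤ 2 / (⌊z⌋₊ + 1) := sum_Ioo_inv_sq_le _ _
    _ ≤ 2 / z := by gcongr; exact (Nat.lt_floor_add_one z).le

/-- The `n ≤ x` from which no pair of primes in `(z, y]` can be extracted cleanly. -/
noncomputable def irregularSet (x y z η : ℝ) : Finset ℕ := by
  classical exact (Finset.Icc 1 ⌊x⌋₊).filter fun n =>
    x * Real.exp (-(2 * η)) < n ∨ (∃ p ∈ primesIoc z y, p * p ∣ n) ∨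
      ((∀ p ∈ primesIoc z y, ¬ p * p ∣ n) ∧ divCount (primesIoc z y) n ≤ 1 ∧
        ∀ p : ℕ, p.Prime → p ∣ n → (p : ℝ) ≤ y)

theorem mem_irregularSet {x y z η : ℝ} {n : ℕ} : n ∈ irregularSet x y z η ↔
    (1 ≤ n ∧ n ≤ ⌊x⌋₊) ∧ (x * Real.exp (-(2 * η)) < n ∨ (∃ p ∈ primesIoc z y, p * p ∣ n) ∨
      ((∀ p ∈ primesIoc z y, ¬ p * p ∣ n) ∧ divCount (primesIoc z y) n ≤ 1 ∧
        ∀ p : ℕ, p.Prime → p ∣ n → (p : ℝ) ≤ y)) := by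
  classical
  unfold irregularSet
  rw [Finset.mem_filter, Finset.mem_Icc]

/-- Dividing out the only possible prime of `(z, y]` costs a factor at most `y` and leaves a
`z`-smooth number of size at least `D`, which is then cut down to at most `D z`. -/
theorem exists_smooth_dvd {y z D : ℝ} (hz : 1 ≤ z) (hD : 1 ≤ D) (hy : 1 ≤ y) {n : ℕ}
    (hn : D * y ≤ n) (hsq : ∀ p ∈ primesIoc z y, ¬ p * p ∣ n)
    (hk : divCount (primesIoc z y) n ≤ 1) (hsm : ∀ p : ℕ, p.Prime → p ∣ n → (p : ℝ) ≤ y) :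
    ∃ d : ℕ, d ∣ n ∧ D ≤ d ∧ (d : ℝ) ≤ D * z ∧ ∀ p : ℕ, p.Prime → p ∣ d → (p : ℝ) ≤ z := by
  obtain ⟨s, hsn, hDs, hs⟩ : ∃ s : ℕ, s ∣ n ∧ D ≤ s ∧
      ∀ p : ℕ, p.Prime → p ∣ s → (p : ℝ) ≤ z := by
    rcases ((primesIoc z y).filter (· ∣ n)).eq_empty_or_nonempty with he | ⟨p₀, hp₀⟩
    · refine ⟨n, dvd_rfl, le_trans (by nlinarith) hn, fun p hp hpn => ?_⟩
      by_contra hlt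
      have : p ∈ (primesIoc z y).filter (· ∣ n) :=
        Finset.mem_filter.2 ⟨mem_primesIoc.2 ⟨hp, not_le.1 hlt, hsm p hp hpn⟩, hpn⟩
      rw [he] at this
      simp at this
    · have hp₀' := Finset.mem_filter.1 hp₀
      have hp₀P := mem_primesIoc.1 hp₀'.1
      obtain ⟨m, rfl⟩ := hp₀'.2
      refine ⟨m, dvd_mul_left _ _, ?_, fun p hp hpm => ?_⟩
      · have hp0 : (0 : ℝ) < y := by linarith
        push_cast at hn
        have : D * y ≤ m * y := by
          calc D * y ≤ p₀ * m := hn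
            _ ≤ y * m := by gcongr; exact hp₀P.2.2
            _ = m * y := mul_comm _ _
        exact le_of_mul_le_mul_right this hp0
      · by_contra hlt
        have hpn : p ∣ p₀ * m := hpm.trans (dvd_mul_left _ _)
        have hpP : p ∈ primesIoc z y := mem_primesIoc.2 ⟨hp, not_le.1 hlt, hsm p hp hpn⟩
        have heq : p = p₀ := Finset.card_le_one.1 hk p (Finset.mem_filter.2 ⟨hpP, hpn⟩) p₀ hp₀
        subst heq
        exact hsq p hpP (mul_dvd_mul_left p hpm)
  obtain ⟨d, hd, h1, h2⟩ := exists_dvd_mem_interval hz hD s hs hDs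
  exact ⟨d, hd.trans hsn, h1, h2, fun p hp hpd => hs p hp (hpd.trans hd)⟩

theorem card_irregularSet_residue_class_le {x y z η D : ℝ} {q : ℕ} [NeZero q] (hη : 0 < η)
    (hx : 0 < x) (hy : 1 ≤ y) (hz : 1 ≤ z) (hD : 1 ≤ D) (hyq : y * q ≤ η * x) (hzη : 2 / z ≤ η)
    (hDz : D * z * q ≤ x) (hDy : D * y ≤ η * x)
    (hsm : ∀ T : Finset ℕ, (∀ d ∈ T, D ≤ d ∧ ∀ p : ℕ, p.Prime → p ∣ d → (p : ℝ) ≤ z) →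
      ∑ d ∈ T, (1 : ℝ) / d ≤ η) (c : ZMod q) (hc : IsUnit c) :
    (((irregularSet x y z η).filter fun m : ℕ => (m : ZMod q) = c).card : ℝ) ≤
      9 * (η * x / q) := by
  classical
  have hq : (0 : ℝ) < q := by exact_mod_cast Nat.pos_of_ne_zero (NeZero.ne q)
  set I := Finset.Icc 1 ⌊x⌋₊ with hI
  have hIx : ∀ n ∈ I, (n : ℝ) ≤ x := fun n hn =>
    (Nat.le_floor_iff hx.le).1 (Finset.mem_Icc.1 hn).2
  set Cl := I.filter fun m : ℕ => (m : ZMod q) = c with hCl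
  set T := (Finset.Icc 1 ⌊D * z⌋₊).filter
    (fun d : ℕ => D ≤ d ∧ ∀ p : ℕ, p.Prime → p ∣ d → (p : ℝ) ≤ z) with hT
  set A₁ := (I.filter fun n : ℕ => x * Real.exp (-(2 * η)) ≤ n).filter
    fun m : ℕ => (m : ZMod q) = c with hA₁
  set A₂ := (I.filter fun n : ℕ => (n : ℝ) ≤ η * x).filter
    fun m : ℕ => (m : ZMod q) = c with hA₂
  set A₃ := (primesIoc z y).biUnion fun p => Cl.filter fun n => p * p ∣ n with hA₃
  set A₄ := T.biUnion fun d => Cl.filter fun n => d ∣ n with hA₄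
  have hsub : ((irregularSet x y z η).filter fun m : ℕ => (m : ZMod q) = c) ⊆
      A₁ ∪ A₂ ∪ A₃ ∪ A₄ := by
    intro n hn
    rw [Finset.mem_filter, mem_irregularSet] at hn
    obtain ⟨⟨hn1, h⟩, hnc⟩ := hn
    have hnI : n ∈ I := Finset.mem_Icc.2 hn1
    have hnCl : n ∈ Cl := Finset.mem_filter.2 ⟨hnI, hnc⟩
    simp only [Finset.mem_union]
    rcases h with h | ⟨p, hp, hpn⟩ | ⟨hsq, hk, hsmooth⟩
    · exact Or.inl (Or.inl (Or.inl (Finset.mem_filter.2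
        ⟨Finset.mem_filter.2 ⟨hnI, h.le⟩, hnc⟩)))
    · exact Or.inl (Or.inr (Finset.mem_biUnion.2 ⟨p, hp, Finset.mem_filter.2 ⟨hnCl, hpn⟩⟩))
    -- The range `n ≤ ηx` is counted trivially, because a smooth divisor is available only once `n ≥
    -- D y`.
    · rcases le_or_gt (n : ℝ) (η * x) with h | h
      · exact Or.inl (Or.inl (Or.inr (Finset.mem_filter.2
          ⟨Finset.mem_filter.2 ⟨hnI, h⟩, hnc⟩)))
      · obtain ⟨d, hdn, h1, h2, h3⟩ := exists_smooth_dvd hz hD hy (hDy.trans h.le) hsq hk hsmooth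
        refine Or.inr (Finset.mem_biUnion.2 ⟨d, ?_, Finset.mem_filter.2 ⟨hnCl, hdn⟩⟩)
        refine Finset.mem_filter.2 ⟨Finset.mem_Icc.2 ⟨?_, Nat.le_floor h2⟩, h1, h3⟩
        exact Nat.pos_of_dvd_of_pos hdn hn1.1
  have h1 : (A₁.card : ℝ) ≤ 2 * (η * x / q) + 1 := by
    refine (card_residue_class_le (u := x * Real.exp (-(2 * η))) (l := 2 * (η * x)) _
      (by positivity) (fun n hn => ?_) c).trans (by rw [mul_div_assoc])
    rw [Finset.mem_filter] at hn
    refine ⟨hn.2, (hIx n hn.1).trans ?_⟩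
    nlinarith [Real.add_one_le_exp (-(2 * η))]
  have h2 : (A₂.card : ℝ) ≤ η * x / q + 1 := by
    refine card_residue_class_le (u := 0) _ (by positivity) (fun n hn => ?_) c
    rw [Finset.mem_filter] at hn
    exact ⟨Nat.cast_nonneg _, by simpa using hn.2⟩
  have h3 : (A₃.card : ℝ) ≤ η * x / q + y := by
    calc (A₃.card : ℝ) ≤ ∑ p ∈ primesIoc z y, ((Cl.filter fun n => p * p ∣ n).card : ℝ) := by
          exact_mod_cast Finset.card_biUnion_le
      _ ≤ ∑ p ∈ primesIoc z y, (x / q * (1 / (p : ℝ) ^ 2) + 1) := by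
          refine Finset.sum_le_sum fun p hp => ?_
          have hp0 := (mem_primesIoc.1 hp).1.pos
          refine (card_multiples_residue_class_le hc hx.le (Nat.mul_pos hp0 hp0) _
            fun n hn => ?_).trans (le_of_eq ?_)
          · rw [Finset.mem_filter, Finset.mem_filter] at hn
            exact ⟨hIx n hn.1.1, hn.1.2, hn.2⟩
          · push_cast
            field_simp
      _ = x / q * ∑ p ∈ primesIoc z y, (1 / (p : ℝ) ^ 2) + (primesIoc z y).card := by
          rw [Finset.sum_add_distrib, Finset.mul_sum]; simp
      _ ≤ x / q * η + y := by
          gcongr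
          · exact (sum_primesIoc_inv_sq_le (by linarith)).trans hzη
          · exact card_primesIoc_le (by linarith)
      _ = _ := by ring
  have h4 : (A₄.card : ℝ) ≤ 2 * (η * x / q) := by
    calc (A₄.card : ℝ) ≤ ∑ d ∈ T, ((Cl.filter fun n => d ∣ n).card : ℝ) := by
          exact_mod_cast Finset.card_biUnion_le
      _ ≤ ∑ d ∈ T, (2 * (x / q) * (1 / (d : ℝ))) := by
          refine Finset.sum_le_sum fun d hd => ?_
          rw [hT, Finset.mem_filter, Finset.mem_Icc] at hd
          have hd0 : (0 : ℝ) < d := by exact_mod_cast hd.1.1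
          have hdz : (d : ℝ) ≤ D * z := (Nat.le_floor_iff (by positivity)).1 hd.1.2
          -- The upper bound `d ≤ D z` is what allows the rounding error `1` to be absorbed.
          have hone : 1 ≤ x / (d * q) := by
            rw [one_le_div (by positivity)]
            refine le_trans ?_ hDz
            gcongr
          calc _ ≤ x / (d * q) + 1 :=
                card_multiples_residue_class_le hc hx.le hd.1.1 _ fun n hn => by
                  rw [Finset.mem_filter, Finset.mem_filter] at hn
                  exact ⟨hIx n hn.1.1, hn.1.2, hn.2⟩
            _ ≤ x / (d * q) + x / (d * q) := by gcongr
            _ = _ := by field_simp; norm_num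
      _ = 2 * (x / q) * ∑ d ∈ T, (1 / (d : ℝ)) := by rw [Finset.mul_sum]
      _ ≤ 2 * (x / q) * η := by
          gcongr
          exact hsm T fun d hd => (Finset.mem_filter.1 hd).2
      _ = _ := by ring
  -- The main terms add up to `6ηx/q`, and the errors `1 + 1 + y` to at most `3y ≤ 3ηx/q`.
  have hyb : y ≤ η * x / q := by rwa [le_div_iff₀ hq]
  have hcard : (((irregularSet x y z η).filter fun m : ℕ => (m : ZMod q) = c).card : ℝ) ≤
      A₁.card + A₂.card + A₃.card + A₄.card := by
    have := Finset.card_le_card hsub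
    have e1 := Finset.card_union_le (A₁ ∪ A₂ ∪ A₃) A₄
    have e2 := Finset.card_union_le (A₁ ∪ A₂) A₃
    have e3 := Finset.card_union_le A₁ A₂
    exact_mod_cast (by omega : _ ≤ A₁.card + A₂.card + A₃.card + A₄.card)
  linarith

/-! ### A logarithmic grid of primes -/

/-- The index of the cell of the grid `z e^{iη}` containing `p`. -/
noncomputable def gridIndex (z η : ℝ) (p : ℕ) : ℕ := ⌊Real.log (p / z) / η⌋₊

/-- The primes of `(z, y]` lying in `[z e^{iη}, z e^{(i+1)η})`. -/
noncomputable def primeCell (z y η : ℝ) (i : ℕ) : Finset ℕ :=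
  (primesIoc z y).filter fun p => gridIndex z η p = i

/-- The lower end of the `i`-th cell. -/
noncomputable def cellStart (z η : ℝ) (i : ℕ) : ℝ := z * Real.exp (i * η)

theorem cellStart_pos {z η : ℝ} (hz : 0 < z) (i : ℕ) : 0 < cellStart z η i := by
  unfold cellStart; positivity

theorem cellStart_succ (z η : ℝ) (i : ℕ) :
    cellStart z η (i + 1) = cellStart z η i * Real.exp η := by
  unfold cellStart
  rw [mul_assoc, ← Real.exp_add]
  push_cast
  ring_nf

theorem le_cellStart {z η : ℝ} (hz : 0 < z) (hη : 0 ≤ η) (i : ℕ) : z ≤ cellStart z η i := by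
  unfold cellStart
  exact le_mul_of_one_le_right hz.le (Real.one_le_exp (by positivity))

theorem cellStart_gridIndex_le {z y η : ℝ} (hz : 0 < z) (hη : 0 < η) {p : ℕ}
    (hp : p ∈ primesIoc z y) : cellStart z η (gridIndex z η p) ≤ p := by
  have hpz := (mem_primesIoc.1 hp).2.1
  have h1 : 1 < p / z := by rwa [one_lt_div hz]
  have h2 : (gridIndex z η p : ℝ) ≤ Real.log (p / z) / η :=
    Nat.floor_le (div_nonneg (Real.log_nonneg h1.le) hη.le)
  rw [le_div_iff₀ hη] at h2
  unfold cellStart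
  calc _ ≤ z * Real.exp (Real.log (p / z)) := by gcongr
    _ = p := by rw [Real.exp_log (by linarith)]; field_simp

theorem lt_cellStart_gridIndex_succ {z y η : ℝ} (hz : 0 < z) (hη : 0 < η) {p : ℕ}
    (hp : p ∈ primesIoc z y) : p < cellStart z η (gridIndex z η p + 1) := by
  have hpz := (mem_primesIoc.1 hp).2.1
  have h1 : 1 < p / z := by rwa [one_lt_div hz]
  have h2 : Real.log (p / z) / η < gridIndex z η p + 1 := Nat.lt_floor_add_one _
  rw [div_lt_iff₀ hη] at h2
  unfold cellStart
  calc (p : ℝ) = z * Real.exp (Real.log (p / z)) := by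
        rw [Real.exp_log (by linarith)]; field_simp
    _ < _ := by push_cast; gcongr

theorem exp_le_one_add_two_mul {η : ℝ} (h0 : 0 ≤ η) (h1 : η ≤ 1) : Real.exp η ≤ 1 + 2 * η := by
  have := Real.abs_exp_sub_one_le (x := η) (by rwa [abs_of_nonneg h0])
  rw [abs_of_nonneg h0] at this
  linarith [le_abs_self (Real.exp η - 1)]

theorem gridIndex_lt {z y η L : ℝ} (hz : 0 < z) (hη : 0 < η) (hL : Real.log (y / z) ≤ L) {p : ℕ}
    (hp : p ∈ primesIoc z y) : gridIndex z η p < ⌊L / η⌋₊ + 1 := by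
  have hp' := mem_primesIoc.1 hp
  have hp0 : (0 : ℝ) < p := by exact_mod_cast hp'.1.pos
  rw [Nat.lt_succ_iff]
  refine Nat.floor_le_floor ?_
  gcongr
  refine le_trans (Real.log_le_log (by positivity) ?_) hL
  gcongr
  exact hp'.2.2

/-- The character sum over the primes in the `i`-th cell. -/
noncomputable def cellSum (f : ArithmeticFunction ℂ) (z y η : ℝ) (i : ℕ) {q : ℕ}
    (χ : DirichletCharacter ℂ q) : ℂ :=
  ∑ p ∈ primeCell z y η i, f p * (starRingEnd ℂ) (χ p)

/-- The threshold beyond which `cellSum` is regarded as large. -/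
noncomputable def cellThreshold (z y η δ L : ℝ) (i : ℕ) : ℝ :=
  δ * ((primeCell z y η i).card + η * cellStart z η i / L)

theorem cellThreshold_nonneg {z y η δ L : ℝ} (hz : 0 < z) (hη : 0 ≤ η) (hδ : 0 ≤ δ) (hL : 0 ≤ L)
    (i : ℕ) : 0 ≤ cellThreshold z y η δ L i := by
  have := cellStart_pos (η := η) hz i
  unfold cellThreshold; positivity

/-- `(a + b)² ≥ 4ab`. The second summand of the threshold serves this inequality, which lets the
large-value estimate apply even to cells with few primes. -/
theorem le_cellThreshold_sq {z y η δ L : ℝ} (i : ℕ) :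
    4 * δ ^ 2 * (primeCell z y η i).card * (η * cellStart z η i / L) ≤
      cellThreshold z y η δ L i ^ 2 := by
  unfold cellThreshold
  nlinarith [sq_nonneg (δ * ((primeCell z y η i).card - η * cellStart z η i / L))]

/-! ### Exceptional characters -/

theorem finite_modChar_le (R : ℝ) : {ψ : ModChar | 1 ≤ ψ.1 ∧ (ψ.1 : ℝ) ≤ R}.Finite := by
  have : {ψ : ModChar | 1 ≤ ψ.1 ∧ (ψ.1 : ℝ) ≤ R} ⊆
      ⋃ r ∈ Set.Icc 1 ⌊R⌋₊, Set.range fun χ : DirichletCharacter ℂ r => (⟨r, χ⟩ : ModChar) := by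
    rintro ⟨r, χ⟩ ⟨h1, h2⟩
    simp only [Set.mem_iUnion]
    exact ⟨r, ⟨h1, Nat.le_floor h2⟩, χ, rfl⟩
  refine Set.Finite.subset (Set.Finite.biUnion (Set.finite_Icc _ _) fun r hr => ?_) this
  have : NeZero r := ⟨by have := hr.1; omega⟩
  exact Set.finite_range _

/-- The primitive characters of conductor at most `R` at which the character sum over the `i`-th
cell is large. -/
noncomputable def cellExceptional (f : ArithmeticFunction ℂ) (z y η δ L R : ℝ) (i : ℕ) :
    Finset ModChar := by
  classical exact (finite_modChar_le R).toFinset.filter fun ψ => ψ.2.IsPrimitive ∧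
    cellThreshold z y η δ L i < ‖cellSum f z y η i ψ.2‖

theorem mem_cellExceptional {f : ArithmeticFunction ℂ} {z y η δ L R : ℝ} {i : ℕ} {ψ : ModChar} :
    ψ ∈ cellExceptional f z y η δ L R i ↔ (1 ≤ ψ.1 ∧ (ψ.1 : ℝ) ≤ R) ∧ ψ.2.IsPrimitive ∧
      cellThreshold z y η δ L i < ‖cellSum f z y η i ψ.2‖ := by
  classical
  unfold cellExceptional
  rw [Finset.mem_filter, Set.Finite.mem_toFinset, Set.mem_ofPred_eq]

/-- The large-value estimate on an interval of length at most `4ηs`, with `t² ≥ 4δ² · #cell · ηs/L`;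
the number of primes in the cell cancels. -/
theorem card_cellExceptional_le {f : ArithmeticFunction ℂ} (hf : ∀ n, ‖f n‖ ≤ 1)
    {z y η δ L R : ℝ} (hz : 0 < z) (hη : 0 < η) (hη1 : η ≤ 1) (hδ : 0 < δ) (hL : 0 < L)
    (hηz : 1 ≤ η * z) (hR : R ^ 2 ≤ δ ^ 2 * (η * z / L)) (i : ℕ) :
    ((cellExceptional f z y η δ L R i).card : ℝ) ≤ 2 * L / δ ^ 2 := by
  rcases (primeCell z y η i).eq_empty_or_nonempty with he | hne
  · have : cellExceptional f z y η δ L R i = ∅ := by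
      refine Finset.eq_empty_of_forall_notMem fun ψ hψ => ?_
      have h1 := (mem_cellExceptional.1 hψ).2.2
      have h2 := cellThreshold_nonneg (y := y) hz hη.le hδ.le hL.le i
      unfold cellSum at h1
      rw [he] at h1
      simp at h1
      linarith
    rw [this]; simp; positivity
  have hs := cellStart_pos (η := η) hz i
  have hzs := le_cellStart hz hη.le i
  have hcard : (0 : ℝ) < (primeCell z y η i).card := by exact_mod_cast hne.card_pos
  have hup : cellStart z η (i + 1) ≤ cellStart z η i + 2 * (η * cellStart z η i) := by
    rw [cellStart_succ]
    nlinarith [exp_le_one_add_two_mul hη.le hη1]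
  have hηs : 1 ≤ η * cellStart z η i := hηz.trans (by gcongr)
  have hsieve := card_mul_sq_le_of_large_values (cellExceptional f z y η δ L R i) (R := R)
    (t := cellThreshold z y η δ L i) (primeCell z y η i) f ⌊cellStart z η i⌋₊
    (⌊cellStart z η (i + 1)⌋₊ + 1 - ⌊cellStart z η i⌋₊)
    (fun ψ hψ => by
      have := mem_cellExceptional.1 hψ
      exact ⟨by have := this.1.1; omega, this.1.2, this.2.1⟩)
    (fun n _ => hf n)
    (by
      intro p hp
      unfold primeCell at hp
      rw [Finset.mem_filter] at hp
      have h1 := cellStart_gridIndex_le hz hη hp.1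
      have h2 := lt_cellStart_gridIndex_succ hz hη hp.1
      rw [hp.2] at h1 h2
      have h3 : ⌊cellStart z η i⌋₊ ≤ p := Nat.floor_le_of_le h1
      have h4 : p ≤ ⌊cellStart z η (i + 1)⌋₊ := Nat.le_floor h2.le
      rw [Finset.mem_Ico]
      omega)
    (cellThreshold_nonneg hz hη.le hδ.le hL.le i)
    (fun ψ hψ => (mem_cellExceptional.1 hψ).2.2.le)
    (by
      refine le_trans ?_ (le_cellThreshold_sq i)
      have : R ^ 2 ≤ δ ^ 2 * (η * cellStart z η i / L) := hR.trans (by gcongr)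
      nlinarith)
  -- The cell has length at most `2ηs`, and rounding adds at most `2 ≤ 2ηs`.
  have hl : ((⌊cellStart z η (i + 1)⌋₊ + 1 - ⌊cellStart z η i⌋₊ : ℕ) : ℝ) ≤
      4 * (η * cellStart z η i) := by
    have h1 : ⌊cellStart z η i⌋₊ ≤ ⌊cellStart z η (i + 1)⌋₊ + 1 := by
      refine (Nat.floor_le_floor ?_).trans (Nat.le_succ _)
      rw [cellStart_succ]
      exact le_mul_of_one_le_right hs.le (Real.one_le_exp hη.le)
    rw [Nat.cast_sub h1]
    push_cast
    have h2 := Nat.floor_le (cellStart_pos (η := η) hz (i + 1)).le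
    have h3 := Nat.lt_floor_add_one (cellStart z η i)
    linarith
  have h5 : ((cellExceptional f z y η δ L R i).card : ℝ) *
      (4 * δ ^ 2 * (primeCell z y η i).card * (η * cellStart z η i / L)) ≤
      2 * (primeCell z y η i).card * (4 * (η * cellStart z η i)) := by
    calc _ ≤ ((cellExceptional f z y η δ L R i).card : ℝ) * cellThreshold z y η δ L i ^ 2 := by
          gcongr; exact le_cellThreshold_sq i
      _ ≤ _ := hsieve
      _ ≤ _ := by gcongr
  rw [le_div_iff₀ (by positivity)]
  have h6 : 0 < 4 * ((primeCell z y η i).card * (η * cellStart z η i)) / L := by positivity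
  refine le_of_mul_le_mul_right ?_ h6
  calc _ = ((cellExceptional f z y η δ L R i).card : ℝ) *
      (4 * δ ^ 2 * (primeCell z y η i).card * (η * cellStart z η i / L)) := by ring
    _ ≤ _ := h5
    _ = _ := by field_simp

/-- The primitive characters of conductor at most `R` at which the character sum over some cell is
large. -/
noncomputable def exceptionalChars (f : ArithmeticFunction ℂ) (z y η δ L R : ℝ) : Finset ModChar := by
  classical exact (Finset.range (⌊L / η⌋₊ + 1)).biUnion fun i => cellExceptional f z y η δ L R i

theorem mem_exceptionalChars {f : ArithmeticFunction ℂ} {z y η δ L R : ℝ} {ψ : ModChar} :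
    ψ ∈ exceptionalChars f z y η δ L R ↔
      ∃ i < ⌊L / η⌋₊ + 1, ψ ∈ cellExceptional f z y η δ L R i := by
  classical
  unfold exceptionalChars
  simp

theorem floor_add_one_mul_le {η L : ℝ} (hη : 0 < η) (hη1 : η ≤ 1) (hL : 1 ≤ L) :
    ((⌊L / η⌋₊ : ℝ) + 1) * η ≤ 2 * L := by
  have := Nat.floor_le (a := L / η) (by positivity)
  rw [le_div_iff₀ hη] at this
  linarith

theorem card_exceptionalChars_le {f : ArithmeticFunction ℂ} (hf : ∀ n, ‖f n‖ ≤ 1)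
    {z y η δ L R : ℝ} (hz : 0 < z) (hη : 0 < η) (hη1 : η ≤ 1) (hδ : 0 < δ) (hL : 1 ≤ L)
    (hηz : 1 ≤ η * z) (hR : R ^ 2 ≤ δ ^ 2 * (η * z / L)) :
    ((exceptionalChars f z y η δ L R).card : ℝ) ≤ 4 * L ^ 2 / (η * δ ^ 2) := by
  classical
  calc ((exceptionalChars f z y η δ L R).card : ℝ) ≤
      ∑ i ∈ Finset.range (⌊L / η⌋₊ + 1), ((cellExceptional f z y η δ L R i).card : ℝ) := by
        unfold exceptionalChars
        exact_mod_cast Finset.card_biUnion_le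
    _ ≤ ∑ i ∈ Finset.range (⌊L / η⌋₊ + 1), 2 * L / δ ^ 2 := Finset.sum_le_sum fun i _ =>
        card_cellExceptional_le hf hz hη hη1 hδ (by linarith) hηz hR i
    _ = ((⌊L / η⌋₊ : ℝ) + 1) * η * (2 * L / (η * δ ^ 2)) := by
        rw [Finset.sum_const, Finset.card_range, nsmul_eq_mul]; push_cast; field_simp
    _ ≤ 2 * L * (2 * L / (η * δ ^ 2)) := by
        exact mul_le_mul_of_nonneg_right (floor_add_one_mul_le hη hη1 hL) (by positivity)
    _ = _ := by ring

/-- The primes of a cell exceed `z ≥ q` and so are coprime to `q`: `χ` and the primitive character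
inducing it have the same cell sum. -/
theorem norm_cellSum_le_threshold {f : ArithmeticFunction ℂ} {z y η δ L R : ℝ} {q : ℕ} [NeZero q]
    (hqR : (q : ℝ) ≤ R) (hqz : (q : ℝ) ≤ z) {χ : DirichletCharacter ℂ q}
    (hχ : χ ∉ inducedChars (exceptionalChars f z y η δ L R) q) {i : ℕ} (hi : i < ⌊L / η⌋₊ + 1) :
    ‖cellSum f z y η i χ‖ ≤ cellThreshold z y η δ L i := by
  classical
  by_contra hlt
  rw [not_le] at hlt
  have hdvd := χ.conductor_dvd_level
  have hq0 : 0 < q := Nat.pos_of_ne_zero (NeZero.ne q)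
  have hχeq : χ = DirichletCharacter.changeLevel hdvd χ.primitiveCharacter :=
    χ.changeLevel_primitiveCharacter.symm
  have hsum : cellSum f z y η i χ.primitiveCharacter = cellSum f z y η i χ := by
    unfold cellSum
    refine Finset.sum_congr rfl fun p hp => ?_
    have hp' := mem_primesIoc.1 (Finset.mem_filter.1 hp).1
    have hcop : p.Coprime q := by
      rw [hp'.1.coprime_iff_not_dvd]
      intro h
      have h1 : (p : ℝ) ≤ q := by exact_mod_cast Nat.le_of_dvd hq0 h
      linarith [hp'.2.1]
    conv_rhs => rw [hχeq, changeLevel_natCast_eq hdvd _ hcop]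
  apply hχ
  unfold inducedChars
  rw [Finset.mem_filter]
  refine ⟨Finset.mem_univ _, ⟨χ.conductor, χ.primitiveCharacter⟩, ?_, hdvd, hχeq⟩
  rw [mem_exceptionalChars]
  refine ⟨i, hi, mem_cellExceptional.2 ⟨⟨?_, ?_⟩, χ.primitiveCharacter_isPrimitive, ?_⟩⟩
  · exact Nat.pos_of_dvd_of_pos hdvd hq0
  · refine le_trans ?_ hqR
    exact_mod_cast Nat.le_of_dvd hq0 hdvd
  · simpa only [hsum] using hlt

/-! ### The contribution of the unexceptional characters -/

/-- The cut-off for the cofactor of a pair of primes. -/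
noncomputable def pairCutoff (x z η : ℝ) (p r : ℕ) : ℝ :=
  x / (cellStart z η (gridIndex z η p + 1) * cellStart z η (gridIndex z η r + 1))

/-- The character sum over the cofactors of pairs of primes in given cells. -/
noncomputable def cofactorSum (f : ArithmeticFunction ℂ) (x z y η : ℝ) (i j : ℕ) {q : ℕ}
    (χ : DirichletCharacter ℂ q) : ℂ :=
  ∑ m ∈ Finset.Icc 1 ⌊x / (cellStart z η (i + 1) * cellStart z η (j + 1))⌋₊,
    f m * pairWeight (primesIoc z y) m * (starRingEnd ℂ) (χ m)

theorem mul_pairCutoff_le {x z y η : ℝ} (hx : 0 ≤ x) (hz : 0 < z) (hη : 0 < η) {p r : ℕ}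
    (hp : p ∈ primesIoc z y) (hr : r ∈ primesIoc z y) : p * r * pairCutoff x z η p r ≤ x := by
  have h1 := lt_cellStart_gridIndex_succ hz hη hp
  have h2 := lt_cellStart_gridIndex_succ hz hη hr
  have h3 := cellStart_pos (η := η) hz (gridIndex z η p + 1)
  have h4 := cellStart_pos (η := η) hz (gridIndex z η r + 1)
  unfold pairCutoff
  rw [mul_div_assoc', div_le_iff₀ (by positivity), mul_comm]
  gcongr

theorem pairCutoff_nonneg {x z η : ℝ} (hx : 0 ≤ x) (hz : 0 < z) (p r : ℕ) :
    0 ≤ pairCutoff x z η p r := by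
  have h3 := cellStart_pos (η := η) hz (gridIndex z η p + 1)
  have h4 := cellStart_pos (η := η) hz (gridIndex z η r + 1)
  unfold pairCutoff
  positivity

/-- The cutoff depends on `p` and `r` through their cells only, so for fixed cells the three
variables separate. -/
theorem sum_pairCoeff_char_eq (f : ArithmeticFunction ℂ) {x z y η L : ℝ} (hx : 0 ≤ x) (hz : 0 < z)
    (hη : 0 < η) (hL : Real.log (y / z) ≤ L) {q : ℕ} (χ : DirichletCharacter ℂ q) :
    ∑ n ∈ Finset.Icc 1 ⌊x⌋₊, pairCoeff f (primesIoc z y) (pairCutoff x z η) n *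
        (starRingEnd ℂ) (χ n) =
      ∑ i ∈ Finset.range (⌊L / η⌋₊ + 1), ∑ j ∈ Finset.range (⌊L / η⌋₊ + 1),
        cellSum f z y η i χ * (cellSum f z y η j χ * cofactorSum f x z y η i j χ) := by
  have hP : ∀ p ∈ primesIoc z y, p.Prime := fun p hp => (mem_primesIoc.1 hp).1
  rw [sum_pairCoeff_mul f hP (fun p hp r hr => mul_pairCutoff_le hx hz hη hp hr)
    (fun p _ r _ => pairCutoff_nonneg hx hz p r) fun n => (starRingEnd ℂ) (χ n)]
  have hmaps : ∀ p ∈ primesIoc z y, gridIndex z η p ∈ Finset.range (⌊L / η⌋₊ + 1) :=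
    fun p hp => Finset.mem_range.2 (gridIndex_lt hz hη hL hp)
  rw [← Finset.sum_fiberwise_of_maps_to hmaps]
  refine Finset.sum_congr rfl fun i _ => ?_
  rw [← Finset.mul_sum]
  unfold cellSum
  rw [Finset.sum_mul]
  refine Finset.sum_congr rfl fun p hp => ?_
  have hpi : gridIndex z η p = i := (Finset.mem_filter.1 hp).2
  rw [← Finset.sum_fiberwise_of_maps_to hmaps, Finset.mul_sum]
  refine Finset.sum_congr rfl fun j _ => ?_
  rw [Finset.sum_mul, Finset.mul_sum]
  refine Finset.sum_congr rfl fun r hr => ?_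
  have hrj : gridIndex z η r = j := (Finset.mem_filter.1 hr).2
  unfold cofactorSum pairCutoff
  rw [hpi, hrj, Finset.mul_sum, Finset.mul_sum, Finset.mul_sum]
  refine Finset.sum_congr rfl fun m _ => ?_
  push_cast
  rw [map_mul, map_mul, map_mul, map_mul]
  ring

theorem sum_norm_sq_cellSum_le {f : ArithmeticFunction ℂ} (hf : ∀ n, ‖f n‖ ≤ 1) {z y η : ℝ}
    (hz : 0 < z) (hη : 0 < η) (hη1 : η ≤ 1) {q : ℕ} [NeZero q] (hq : (q : ℝ) ≤ η * z) (i : ℕ) :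
    ∑ χ : DirichletCharacter ℂ q, ‖cellSum f z y η i χ‖ ^ 2 ≤
      3 * (η * cellStart z η i) * (primeCell z y η i).card := by
  have hq0 : (0 : ℝ) < q := by exact_mod_cast Nat.pos_of_ne_zero (NeZero.ne q)
  have hs := cellStart_pos (η := η) hz i
  have hup : cellStart z η (i + 1) ≤ cellStart z η i + 2 * (η * cellStart z η i) := by
    rw [cellStart_succ]
    nlinarith [exp_le_one_add_two_mul hη.le hη1]
  have hqs : (q : ℝ) ≤ η * cellStart z η i :=
    hq.trans (mul_le_mul_of_nonneg_left (le_cellStart hz hη.le i) hη.le)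
  refine (sum_norm_sq_char_le (primeCell z y η i) f (W := 1)
    (K := 2 * (η * cellStart z η i) / q + 1) (fun n _ => hf n) (fun n _ _ => ?_)
    (by positivity)).trans ?_
  · refine card_residue_class_le (u := cellStart z η i) _ (by positivity) (fun p hp => ?_) _
    unfold primeCell at hp
    rw [Finset.mem_filter] at hp
    have h1 := cellStart_gridIndex_le hz hη hp.1
    have h2 := lt_cellStart_gridIndex_succ hz hη hp.1
    rw [hp.2] at h1 h2
    exact ⟨h1, h2.le.trans hup⟩
  · calc _ ≤ (q : ℝ) * (1 ^ 2 * (2 * (η * cellStart z η i) / q + 1) *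
          (primeCell z y η i).card) := by gcongr; exact Nat.totient_le q
      _ = (2 * (η * cellStart z η i) + q) * (primeCell z y η i).card := by field_simp
      _ ≤ (2 * (η * cellStart z η i) + η * cellStart z η i) * (primeCell z y η i).card := by
          gcongr
      _ = _ := by ring

theorem sum_norm_sq_cofactorSum_le {f : ArithmeticFunction ℂ} (hf : ∀ n, ‖f n‖ ≤ 1)
    {x z y η : ℝ} {q : ℕ} [NeZero q] {i j : ℕ}
    (hq : (q : ℝ) ≤ x / (cellStart z η (i + 1) * cellStart z η (j + 1))) :
    ∑ χ : DirichletCharacter ℂ q, ‖cofactorSum f x z y η i j χ‖ ^ 2 ≤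
      2 * (x / (cellStart z η (i + 1) * cellStart z η (j + 1))) ^ 2 := by
  have hq0 : (0 : ℝ) < q := by exact_mod_cast Nat.pos_of_ne_zero (NeZero.ne q)
  set X := x / (cellStart z η (i + 1) * cellStart z η (j + 1)) with hX
  have hX0 : 0 < X := hq0.trans_le hq
  refine (sum_norm_sq_char_le (Finset.Icc 1 ⌊X⌋₊)
    (fun m => f m * (pairWeight (primesIoc z y) m : ℂ)) (W := 1)
    (K := X / q + 1) (fun n _ => ?_) (fun n _ _ => ?_) (by positivity)).trans ?_
  · rw [norm_mul, Complex.norm_real, Real.norm_of_nonneg (pairWeight_nonneg _ _)]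
    exact mul_le_one₀ (hf _) (pairWeight_nonneg _ _) (pairWeight_le_one _ _)
  · refine card_residue_class_le (u := 0) _ hX0.le (fun m hm => ?_) _
    rw [Finset.mem_Icc, Nat.le_floor_iff hX0.le] at hm
    exact ⟨Nat.cast_nonneg _, by simpa using hm.2⟩
  · rw [Nat.card_Icc, Nat.add_sub_cancel]
    calc _ ≤ (q : ℝ) * (1 ^ 2 * (X / q + 1) * X) := by
          gcongr
          · exact Nat.totient_le q
          · exact Nat.floor_le hX0.le
      _ = (X + q) * X := by field_simp
      _ ≤ (X + X) * X := by gcongr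
      _ = _ := by ring

theorem sum_card_primeCell_div_le {z y η L : ℝ} (hz : 0 < z) (hη : 0 < η) (hη1 : η ≤ 1)
    (hL : Real.log (y / z) ≤ L) :
    ∑ i ∈ Finset.range (⌊L / η⌋₊ + 1), ((primeCell z y η i).card : ℝ) / cellStart z η i ≤
      3 * ∑ p ∈ primesIoc z y, (1 : ℝ) / p := by
  have hmaps : ∀ p ∈ primesIoc z y, gridIndex z η p ∈ Finset.range (⌊L / η⌋₊ + 1) :=
    fun p hp => Finset.mem_range.2 (gridIndex_lt hz hη hL hp)
  rw [← Finset.sum_fiberwise_of_maps_to hmaps, Finset.mul_sum]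
  refine Finset.sum_le_sum fun i _ => ?_
  have hs := cellStart_pos (η := η) hz i
  calc _ = ∑ p ∈ primeCell z y η i, (1 : ℝ) / cellStart z η i := by
        rw [Finset.sum_const, nsmul_eq_mul, mul_one_div]
    _ ≤ ∑ p ∈ primeCell z y η i, 3 * ((1 : ℝ) / p) := by
        refine Finset.sum_le_sum fun p hp => ?_
        unfold primeCell at hp
        rw [Finset.mem_filter] at hp
        have hp0 : (0 : ℝ) < p := by exact_mod_cast (mem_primesIoc.1 hp.1).1.pos
        have h2 := lt_cellStart_gridIndex_succ hz hη hp.1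
        rw [hp.2, cellStart_succ] at h2
        have h3 : Real.exp η ≤ 3 := by linarith [exp_le_one_add_two_mul hη.le hη1]
        rw [mul_one_div, div_le_div_iff₀ hs hp0, one_mul]
        nlinarith
    _ = _ := by rw [Finset.mul_sum]; rfl

/-- The threshold bounds the first factor for each unexceptional `χ`; Cauchy–Schwarz over `χ` and
the mean values modulo `q` handle the product of the other two. -/
theorem sum_norm_cell_product_le {f : ArithmeticFunction ℂ} (hf : ∀ n, ‖f n‖ ≤ 1)
    {x z y η δ L R : ℝ} (hx : 0 < x) (hz : 0 < z) (hη : 0 < η) (hη1 : η ≤ 1) (hδ : 0 ≤ δ)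
    (hL1 : 0 ≤ L) {q : ℕ} [NeZero q] (hqR : (q : ℝ) ≤ R)
    (hq : (q : ℝ) ≤ η * z) (hqX : q * (9 * y ^ 2) ≤ x) (A : Finset (DirichletCharacter ℂ q))
    (hA : ∀ χ ∈ A, χ ∉ inducedChars (exceptionalChars f z y η δ L R) q) {i : ℕ}
    (hi : i < ⌊L / η⌋₊ + 1) (j : ℕ) :
    ∑ χ ∈ A, ‖cellSum f z y η i χ * (cellSum f z y η j χ * cofactorSum f x z y η i j χ)‖ ≤
      x * (cellThreshold z y η δ L i / cellStart z η i *
        √(6 * η * ((primeCell z y η j).card / cellStart z η j))) := by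
  have hqz : (q : ℝ) ≤ z := hq.trans (mul_le_of_le_one_left hz.le hη1)
  have hsi := cellStart_pos (η := η) hz i
  have hsj := cellStart_pos (η := η) hz j
  have hti := cellThreshold_nonneg (y := y) (L := L) hz hη.le hδ hL1 i
  rcases (primeCell z y η i).eq_empty_or_nonempty with he | ⟨p, hp⟩
  · have : ∀ χ : DirichletCharacter ℂ q, cellSum f z y η i χ = 0 := by
      intro χ; unfold cellSum; rw [he]; simp
    simp only [this, zero_mul, norm_zero, Finset.sum_const_zero]
    positivity
  rcases (primeCell z y η j).eq_empty_or_nonempty with he | ⟨r, hr⟩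
  · have : ∀ χ : DirichletCharacter ℂ q, cellSum f z y η j χ = 0 := by
      intro χ; unfold cellSum; rw [he]; simp
    simp only [this, zero_mul, mul_zero, norm_zero, Finset.sum_const_zero]
    positivity
  -- A nonempty cell ends below `3y`, so the cofactor range has length at least `x/(9y²) ≥ q`, as
  -- its mean value requires.
  have hend : ∀ (k p : ℕ), p ∈ primeCell z y η k → cellStart z η (k + 1) ≤ 3 * y := by
    intro k p hp
    unfold primeCell at hp
    rw [Finset.mem_filter] at hp
    have h1 := cellStart_gridIndex_le hz hη hp.1
    have h2 := (mem_primesIoc.1 hp.1).2.2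
    rw [hp.2] at h1
    have h3 : Real.exp η ≤ 3 := by linarith [exp_le_one_add_two_mul hη.le hη1]
    rw [cellStart_succ, mul_comm]
    have := cellStart_pos (η := η) hz k
    gcongr
    linarith
  have hsi1 := cellStart_pos (η := η) hz (i + 1)
  have hsj1 := cellStart_pos (η := η) hz (j + 1)
  have hX : (q : ℝ) ≤ x / (cellStart z η (i + 1) * cellStart z η (j + 1)) := by
    rw [le_div_iff₀ (by positivity)]
    refine le_trans ?_ hqX
    have h1 := hend i p hp
    have h2 := hend j r hr
    calc _ ≤ (q : ℝ) * ((3 * y) * (3 * y)) := by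
          gcongr
          exact hsi1.le.trans h1
      _ = _ := by ring
  have hXle : x / (cellStart z η (i + 1) * cellStart z η (j + 1)) ≤
      x / (cellStart z η i * cellStart z η j) := by
    have h1 : cellStart z η i ≤ cellStart z η (i + 1) := by
      rw [cellStart_succ]; exact le_mul_of_one_le_right hsi.le (Real.one_le_exp hη.le)
    have h2 : cellStart z η j ≤ cellStart z η (j + 1) := by
      rw [cellStart_succ]; exact le_mul_of_one_le_right hsj.le (Real.one_le_exp hη.le)
    gcongr
  calc _ ≤ ∑ χ ∈ A, cellThreshold z y η δ L i *
        (‖cellSum f z y η j χ‖ * ‖cofactorSum f x z y η i j χ‖) := by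
        refine Finset.sum_le_sum fun χ hχ => ?_
        rw [norm_mul, norm_mul]
        gcongr
        exact norm_cellSum_le_threshold hqR hqz (hA χ hχ) hi
    _ = cellThreshold z y η δ L i *
        ∑ χ ∈ A, ‖cellSum f z y η j χ‖ * ‖cofactorSum f x z y η i j χ‖ := by
        rw [Finset.mul_sum]
    _ ≤ cellThreshold z y η δ L i *
        (√(∑ χ : DirichletCharacter ℂ q, ‖cellSum f z y η j χ‖ ^ 2) *
          √(∑ χ : DirichletCharacter ℂ q, ‖cofactorSum f x z y η i j χ‖ ^ 2)) := by
        gcongr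
        refine (Real.sum_mul_le_sqrt_mul_sqrt _ _ _).trans ?_
        gcongr
        · exact Finset.subset_univ A
        · exact Finset.subset_univ A
    _ ≤ cellThreshold z y η δ L i *
        (√(3 * (η * cellStart z η j) * (primeCell z y η j).card) *
          √(2 * (x / (cellStart z η i * cellStart z η j)) ^ 2)) := by
        gcongr
        · exact sum_norm_sq_cellSum_le hf hz hη hη1 hq j
        · refine (sum_norm_sq_cofactorSum_le hf hX).trans ?_
          gcongr
    _ = cellThreshold z y η δ L i * √((x / cellStart z η i) ^ 2 *
          (6 * η * ((primeCell z y η j).card / cellStart z η j))) := by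
        rw [← Real.sqrt_mul (by positivity)]
        congr 2
        field_simp
        ring
    _ = _ := by
        rw [Real.sqrt_mul (by positivity), Real.sqrt_sq (by positivity)]
        ring

/-- The extra summand of the threshold contributes `δη/L` per cell, hence at most `2δ` over the at
most `2L/η` cells. -/
theorem sum_cellThreshold_div_le {z y η δ L : ℝ} (hz : 0 < z) (hη : 0 < η) (hη1 : η ≤ 1)
    (hδ : 0 ≤ δ) (hL1 : 1 ≤ L) (hL : Real.log (y / z) ≤ L) :
    ∑ i ∈ Finset.range (⌊L / η⌋₊ + 1), cellThreshold z y η δ L i / cellStart z η i ≤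
      δ * (3 * ∑ p ∈ primesIoc z y, (1 : ℝ) / p + 2) := by
  have hN : ((⌊L / η⌋₊ : ℝ) + 1) * η ≤ 2 * L := floor_add_one_mul_le hη hη1 hL1
  have hmass := sum_card_primeCell_div_le (y := y) hz hη hη1 hL
  have hL0 : 0 < L := by linarith
  calc _ = ∑ i ∈ Finset.range (⌊L / η⌋₊ + 1),
        (δ * ((primeCell z y η i).card / cellStart z η i) + δ * (η / L)) := by
        refine Finset.sum_congr rfl fun i _ => ?_
        have hsi := cellStart_pos (η := η) hz i
        unfold cellThreshold
        field_simp
    _ = δ * ∑ i ∈ Finset.range (⌊L / η⌋₊ + 1), ((primeCell z y η i).card : ℝ) / cellStart z η i +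
        δ * ((((⌊L / η⌋₊ : ℝ) + 1) * η) / L) := by
        rw [Finset.sum_add_distrib, ← Finset.mul_sum, Finset.sum_const, Finset.card_range,
          nsmul_eq_mul]
        push_cast; ring
    _ ≤ δ * (3 * ∑ p ∈ primesIoc z y, (1 : ℝ) / p) + δ * (2 * L / L) := by gcongr
    _ = _ := by field_simp

/-- Cauchy–Schwarz over the cells; their number times `η` is at most `2L`, the source of the loss
`L^(1/2)`. -/
theorem sum_sqrt_card_primeCell_le {z y η L : ℝ} (hz : 0 < z) (hη : 0 < η) (hη1 : η ≤ 1)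
    (hL1 : 1 ≤ L) (hL : Real.log (y / z) ≤ L) :
    ∑ j ∈ Finset.range (⌊L / η⌋₊ + 1),
        √(6 * η * ((primeCell z y η j).card / cellStart z η j)) ≤
      √(36 * L * ∑ p ∈ primesIoc z y, (1 : ℝ) / p) := by
  have hN : ((⌊L / η⌋₊ : ℝ) + 1) * η ≤ 2 * L := floor_add_one_mul_le hη hη1 hL1
  have hmass := sum_card_primeCell_div_le (y := y) hz hη hη1 hL
  set Sg := ∑ p ∈ primesIoc z y, (1 : ℝ) / p with hSg
  refine Real.le_sqrt_of_sq_le (sq_sum_le_card_mul_sum_sq.trans ?_)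
  have : ∀ j ∈ Finset.range (⌊L / η⌋₊ + 1),
      √(6 * η * ((primeCell z y η j).card / cellStart z η j)) ^ 2 =
        6 * η * ((primeCell z y η j).card / cellStart z η j) := by
    intro j _
    have hsj := cellStart_pos (η := η) hz j
    exact Real.sq_sqrt (by positivity)
  rw [Finset.sum_congr rfl this, ← Finset.mul_sum, Finset.card_range]
  push_cast
  calc _ = 6 * (((⌊L / η⌋₊ : ℝ) + 1) * η) *
        ∑ j ∈ Finset.range (⌊L / η⌋₊ + 1), ((primeCell z y η j).card : ℝ) / cellStart z η j := by
        ring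
    _ ≤ 6 * (2 * L) * (3 * Sg) := by
        refine mul_le_mul (by linarith) hmass (Finset.sum_nonneg fun j _ =>
          div_nonneg (Nat.cast_nonneg _) (cellStart_pos (η := η) hz j).le) (by linarith)
    _ = _ := by ring

/-- The sum over unexceptional characters of the bilinear part. -/
theorem sum_norm_pairCoeff_char_le {f : ArithmeticFunction ℂ} (hf : ∀ n, ‖f n‖ ≤ 1)
    {x z y η δ L R : ℝ} (hx : 0 < x) (hz : 0 < z) (hη : 0 < η) (hη1 : η ≤ 1) (hδ : 0 ≤ δ)
    (hL1 : 1 ≤ L) (hL : Real.log (y / z) ≤ L) {q : ℕ} [NeZero q] (hqR : (q : ℝ) ≤ R)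
    (hq : (q : ℝ) ≤ η * z) (hqX : q * (9 * y ^ 2) ≤ x) :
    ∑ χ ∈ Finset.univ \ inducedChars (exceptionalChars f z y η δ L R) q,
        ‖∑ n ∈ Finset.Icc 1 ⌊x⌋₊, pairCoeff f (primesIoc z y) (pairCutoff x z η) n *
          (starRingEnd ℂ) (χ n)‖ ≤
      x * (δ * (3 * ∑ p ∈ primesIoc z y, (1 : ℝ) / p + 2)) *
        √(36 * L * ∑ p ∈ primesIoc z y, (1 : ℝ) / p) := by
  classical
  set A := Finset.univ \ inducedChars (exceptionalChars f z y η δ L R) q with hA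
  set I := Finset.range (⌊L / η⌋₊ + 1) with hI
  calc _ ≤ ∑ χ ∈ A, ∑ i ∈ I, ∑ j ∈ I,
        ‖cellSum f z y η i χ * (cellSum f z y η j χ * cofactorSum f x z y η i j χ)‖ := by
        refine Finset.sum_le_sum fun χ _ => ?_
        rw [sum_pairCoeff_char_eq f hx.le hz hη hL χ]
        exact norm_sum_le_of_le _ fun i _ => norm_sum_le _ _
    _ = ∑ i ∈ I, ∑ j ∈ I, ∑ χ ∈ A,
        ‖cellSum f z y η i χ * (cellSum f z y η j χ * cofactorSum f x z y η i j χ)‖ := by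
        rw [Finset.sum_comm]
        exact Finset.sum_congr rfl fun i _ => Finset.sum_comm
    _ ≤ ∑ i ∈ I, ∑ j ∈ I, x * (cellThreshold z y η δ L i / cellStart z η i *
        √(6 * η * ((primeCell z y η j).card / cellStart z η j))) :=
        Finset.sum_le_sum fun i hi => Finset.sum_le_sum fun j _ =>
          sum_norm_cell_product_le hf hx hz hη hη1 hδ (by linarith) hqR hq hqX A
            (fun χ hχ => (Finset.mem_sdiff.1 hχ).2) (Finset.mem_range.1 hi) j
    _ = x * (∑ i ∈ I, cellThreshold z y η δ L i / cellStart z η i) *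
        ∑ j ∈ I, √(6 * η * ((primeCell z y η j).card / cellStart z η j)) := by
        rw [mul_assoc, Finset.sum_mul_sum, Finset.mul_sum]
        exact Finset.sum_congr rfl fun i _ => by rw [Finset.mul_sum]
    _ ≤ _ := by
        have h1 := sum_cellThreshold_div_le (δ := δ) hz hη hη1 hδ hL1 hL
        have h2 := sum_sqrt_card_primeCell_le hz hη hη1 hL1 hL
        have h3 : 0 ≤ δ * (3 * ∑ p ∈ primesIoc z y, (1 : ℝ) / p + 2) := by positivity
        exact mul_le_mul (mul_le_mul_of_nonneg_left h1 hx.le) h2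
          (Finset.sum_nonneg fun _ _ => Real.sqrt_nonneg _) (by positivity)

/-! ### Bounding the discrepancy -/

/-- The margin `n ≤ x e^(-2η)` compensates for replacing `p` and `r` by the ends of their cells.
When fewer than two primes can be extracted, regularity of `n` means it is not `y`-smooth, so both
sides vanish. -/
theorem eq_pairCoeff_of_notMem_irregularSet {f : ArithmeticFunction ℂ} (hf : f.IsMultiplicative)
    {x y z η : ℝ} (hx : 0 < x) (hz : 0 < z) (hη : 0 < η) (hsupp : SupportedOnSmooth f y) {n : ℕ}
    (hn : n ∈ Finset.Icc 1 ⌊x⌋₊) (hreg : n ∉ irregularSet x y z η) :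
    f n = pairCoeff f (primesIoc z y) (pairCutoff x z η) n := by
  rw [mem_irregularSet, not_and] at hreg
  have h := hreg (Finset.mem_Icc.1 hn)
  rw [not_or, not_or, not_lt] at h
  obtain ⟨hnx, hsq, hsm⟩ := h
  have hsq' : ∀ p ∈ primesIoc z y, ¬ p * p ∣ n := fun p hp hd => hsq ⟨p, hp, hd⟩
  rcases le_or_gt 2 (divCount (primesIoc z y) n) with hk | hk
  · refine (pairCoeff_eq hf (fun p hp => (mem_primesIoc.1 hp).1) hsq' hk
      fun p hp r hr hd => ?_).symm
    have hp0 : (0 : ℝ) < p := by exact_mod_cast (mem_primesIoc.1 hp).1.pos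
    have hr0 : (0 : ℝ) < r := by exact_mod_cast (mem_primesIoc.1 hr).1.pos
    have h1 := cellStart_gridIndex_le hz hη hp
    have h2 := cellStart_gridIndex_le hz hη hr
    have h3 := cellStart_pos (η := η) hz (gridIndex z η p)
    have h4 := cellStart_pos (η := η) hz (gridIndex z η r)
    unfold pairCutoff
    rw [cellStart_succ, cellStart_succ]
    refine Nat.cast_div_le.trans ?_
    push_cast
    rw [div_le_div_iff₀ (by positivity) (by positivity)]
    calc _ ≤ (x * Real.exp (-(2 * η))) * ((p * Real.exp η) * (r * Real.exp η)) := by gcongr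
      _ = x * (p * r) * (Real.exp (-(2 * η)) * (Real.exp η * Real.exp η)) := by ring
      _ = x * (p * r) := by rw [← Real.exp_add, ← Real.exp_add]; ring_nf; simp
  · rw [pairCoeff_eq_zero hsq' (by omega)]
    by_contra hne
    exact hsm ⟨hsq', by omega, hsupp n hne⟩

open Classical in
theorem card_inducedChars_le (Ξ : Finset ModChar) (q : ℕ) [NeZero q] :
    (inducedChars Ξ q).card ≤ Ξ.card := by
  have : inducedChars Ξ q ⊆ Ξ.image fun ψ : ModChar =>
      if h : ψ.1 ∣ q then DirichletCharacter.changeLevel h ψ.2 else 1 := by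
    intro χ hχ
    unfold inducedChars at hχ
    obtain ⟨ψ, hψ, h, hχψ⟩ := (Finset.mem_filter.1 hχ).2
    refine Finset.mem_image.2 ⟨ψ, hψ, ?_⟩
    rw [dif_pos h, hχψ]
  exact (Finset.card_le_card this).trans Finset.card_image_le

/-- Split `f = u + (f - u)` and expand the sum of `u` over the class in all characters: its part
over `Ξ_q` cancels against the subtracted main term. -/
theorem totient_mul_discrepancy_eq (Ξ : Finset ModChar) (f : ArithmeticFunction ℂ) (x : ℝ) {q : ℕ}
    [NeZero q] (a : ℤ) (ha : IsCoprime a (q : ℤ)) (u : ℕ → ℂ) :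
    (q.totient : ℂ) * discrepancy Ξ f x q a =
      ∑ χ ∈ Finset.univ \ inducedChars Ξ q,
        χ (a : ZMod q) * ∑ n ∈ Finset.Icc 1 ⌊x⌋₊, u n * (starRingEnd ℂ) (χ n) +
      q.totient * ∑ n ∈ (Finset.Icc 1 ⌊x⌋₊).filter (fun n : ℕ => (n : ℤ) ≡ a [ZMOD q]),
        (f n - u n) -
      ∑ χ ∈ inducedChars Ξ q,
        χ (a : ZMod q) * ∑ n ∈ Finset.Icc 1 ⌊x⌋₊, (f n - u n) * (starRingEnd ℂ) (χ n) := by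
  classical
  have hφ : (q.totient : ℂ) ≠ 0 := by
    have := Nat.totient_pos.2 (Nat.pos_of_ne_zero (NeZero.ne q))
    exact_mod_cast this.ne'
  have h1 := sum_residue_class_eq (Finset.Icc 1 ⌊x⌋₊) u a ha
  rw [← Finset.sum_sdiff (Finset.subset_univ (inducedChars Ξ q))] at h1
  unfold discrepancy charSum
  rw [mul_sub, ← mul_assoc, mul_one_div_cancel hφ, one_mul, Finset.sum_sub_distrib, mul_sub, h1]
  simp_rw [sub_mul, Finset.sum_sub_distrib, mul_sub]
  rw [Finset.sum_sub_distrib]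
  ring

/-- The difference `f - u` is at most `3` and lives on the irregular set. Its character sums have
mean square at most `(3K)²`, so Cauchy–Schwarz over `Ξ_q` loses only `√|Ξ|`. -/
theorem totient_mul_norm_discrepancy_le {f : ArithmeticFunction ℂ} (hmul : f.IsMultiplicative)
    (hf : ∀ n, ‖f n‖ ≤ 1) {x y z η K : ℝ} (hx : 0 < x) (hz : 0 < z) (hη : 0 < η)
    (hsupp : SupportedOnSmooth f y) (hK : 0 ≤ K) {q : ℕ} [NeZero q]
    (hcard : ((irregularSet x y z η).card : ℝ) ≤ K)
    (hclass : ∀ c : ZMod q, IsUnit c →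
      (((irregularSet x y z η).filter fun m : ℕ => (m : ZMod q) = c).card : ℝ) ≤ K / q)
    (Ξ : Finset ModChar) (a : ℤ) (ha : IsCoprime a (q : ℤ)) :
    (q.totient : ℝ) * ‖discrepancy Ξ f x q a‖ ≤
      ∑ χ ∈ Finset.univ \ inducedChars Ξ q,
        ‖∑ n ∈ Finset.Icc 1 ⌊x⌋₊, pairCoeff f (primesIoc z y) (pairCutoff x z η) n *
          (starRingEnd ℂ) (χ n)‖ + 3 * K * (1 + √Ξ.card) := by
  classical
  have hq0 : (0 : ℝ) < q := by exact_mod_cast Nat.pos_of_ne_zero (NeZero.ne q)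
  have hP : ∀ p ∈ primesIoc z y, p.Prime := fun p hp => (mem_primesIoc.1 hp).1
  set u := pairCoeff f (primesIoc z y) (pairCutoff x z η) with hu
  set S := irregularSet x y z η with hS
  have hSsub : S ⊆ Finset.Icc 1 ⌊x⌋₊ := fun n hn => Finset.mem_Icc.2 (mem_irregularSet.1 hn).1
  have hE : ∀ n, ‖f n - u n‖ ≤ 3 := fun n => by
    refine (norm_sub_le _ _).trans ?_
    linarith [hf n, norm_pairCoeff_le hf hP (pairCutoff x z η) n]
  have hE0 : ∀ n ∈ Finset.Icc 1 ⌊x⌋₊, n ∉ S → f n - u n = 0 := fun n hn hnS =>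
    sub_eq_zero.2 (eq_pairCoeff_of_notMem_irregularSet hmul hx hz hη hsupp hn hnS)
  have hau : IsUnit (a : ZMod q) := by
    rw [← ZMod.coe_unitOfIsCoprime a ha]; exact Units.isUnit _
  have h1 : ‖∑ n ∈ (Finset.Icc 1 ⌊x⌋₊).filter (fun n : ℕ => (n : ℤ) ≡ a [ZMOD q]),
      (f n - u n)‖ ≤ 3 * (K / q) := by
    have hsub : (S.filter fun m : ℕ => (m : ZMod q) = a) ⊆
        (Finset.Icc 1 ⌊x⌋₊).filter (fun n : ℕ => (n : ℤ) ≡ a [ZMOD q]) := by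
      intro n hn
      rw [Finset.mem_filter] at hn ⊢
      refine ⟨hSsub hn.1, ?_⟩
      rw [← ZMod.intCast_eq_intCast_iff]
      simpa using hn.2
    rw [← Finset.sum_subset hsub fun n hn hn' => ?_]
    · calc _ ≤ ∑ n ∈ S.filter fun m : ℕ => (m : ZMod q) = a, (3 : ℝ) :=
            norm_sum_le_of_le _ fun n _ => hE n
        _ = 3 * ((S.filter fun m : ℕ => (m : ZMod q) = a).card : ℝ) := by
            rw [Finset.sum_const, nsmul_eq_mul, mul_comm]
        _ ≤ _ := by gcongr; exact hclass _ hau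
    · rw [Finset.mem_filter] at hn
      refine hE0 n hn.1 fun hnS => hn' (Finset.mem_filter.2 ⟨hnS, ?_⟩)
      have := (ZMod.intCast_eq_intCast_iff _ _ _).2 hn.2
      simpa using this
  have h2 : ∑ χ ∈ inducedChars Ξ q,
      ‖∑ n ∈ Finset.Icc 1 ⌊x⌋₊, (f n - u n) * (starRingEnd ℂ) (χ n)‖ ≤ 3 * K * √Ξ.card := by
    have hmean : ∑ χ : DirichletCharacter ℂ q,
        ‖∑ n ∈ Finset.Icc 1 ⌊x⌋₊, (f n - u n) * (starRingEnd ℂ) (χ n)‖ ^ 2 ≤ (3 * K) ^ 2 := by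
      have : ∀ χ : DirichletCharacter ℂ q,
          ∑ n ∈ Finset.Icc 1 ⌊x⌋₊, (f n - u n) * (starRingEnd ℂ) (χ n) =
          ∑ n ∈ S, (f n - u n) * (starRingEnd ℂ) (χ n) := fun χ =>
        (Finset.sum_subset hSsub fun n hn hnS => by rw [hE0 n hn hnS, zero_mul]).symm
      simp_rw [this]
      refine (sum_norm_sq_char_le S (fun n => f n - u n) (fun n _ => hE n)
        (fun n _ hn => hclass n hn) (by positivity)).trans ?_
      calc _ ≤ (q : ℝ) * (3 ^ 2 * (K / q) * K) := by
            gcongr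
            exact Nat.totient_le q
        _ = _ := by field_simp
    have hcs := Real.sum_mul_le_sqrt_mul_sqrt (inducedChars Ξ q)
      (fun χ => ‖∑ n ∈ Finset.Icc 1 ⌊x⌋₊, (f n - u n) * (starRingEnd ℂ) (χ n)‖) fun _ => 1
    simp only [mul_one, one_pow, Finset.sum_const, nsmul_eq_mul] at hcs
    refine hcs.trans ?_
    rw [← Real.sqrt_sq (by positivity : 0 ≤ 3 * K)]
    gcongr
    · refine le_trans ?_ hmean
      exact Finset.sum_le_sum_of_subset_of_nonneg (Finset.subset_univ _) fun _ _ _ => by positivity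
    · exact card_inducedChars_le Ξ q
  have h3 : (q.totient : ℝ) * ‖discrepancy Ξ f x q a‖ = ‖(q.totient : ℂ) * discrepancy Ξ f x q a‖ := by
    rw [norm_mul, Complex.norm_natCast]
  rw [h3, totient_mul_discrepancy_eq Ξ f x a ha u]
  have hχa : ∀ (χ : DirichletCharacter ℂ q) (w : ℂ), ‖χ (a : ZMod q) * w‖ ≤ ‖w‖ := fun χ w => by
    rw [norm_mul]
    exact mul_le_of_le_one_left (norm_nonneg _) (χ.norm_le_one _)
  refine (norm_sub_le _ _).trans ((add_le_add_left (norm_add_le _ _) _).trans ?_)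
  have e1 : ‖∑ χ ∈ Finset.univ \ inducedChars Ξ q,
      χ (a : ZMod q) * ∑ n ∈ Finset.Icc 1 ⌊x⌋₊, u n * (starRingEnd ℂ) (χ n)‖ ≤
      ∑ χ ∈ Finset.univ \ inducedChars Ξ q,
        ‖∑ n ∈ Finset.Icc 1 ⌊x⌋₊, u n * (starRingEnd ℂ) (χ n)‖ :=
    norm_sum_le_of_le _ fun χ _ => hχa χ _
  have e2 : ‖∑ χ ∈ inducedChars Ξ q,
      χ (a : ZMod q) * ∑ n ∈ Finset.Icc 1 ⌊x⌋₊, (f n - u n) * (starRingEnd ℂ) (χ n)‖ ≤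
      3 * K * √Ξ.card :=
    (norm_sum_le_of_le _ fun χ _ => hχa χ _).trans h2
  have e3 : ‖(q.totient : ℂ) * ∑ n ∈ (Finset.Icc 1 ⌊x⌋₊).filter
      (fun n : ℕ => (n : ℤ) ≡ a [ZMOD q]), (f n - u n)‖ ≤ 3 * K := by
    rw [norm_mul, Complex.norm_natCast]
    calc _ ≤ (q : ℝ) * (3 * (K / q)) := by
          gcongr
          exact Nat.totient_le q
      _ = _ := by field_simp
  linarith

/-! ### Choice of parameters -/

theorem exists_forall_sq_le_exp (C : ℝ) :
    ∃ l₀ : ℝ, ∀ l, l₀ ≤ l → C * l ^ 2 ≤ Real.exp (l / 8) ∧ C ≤ l := by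
  have h1 := isLittleO_pow_exp_pos_mul_atTop 2 (b := 1 / 8) (by norm_num)
  have h2 := h1.bound (c := 1 / (|C| + 1)) (by positivity)
  obtain ⟨l₀, hl₀⟩ := eventually_atTop.1 (h2.and (eventually_ge_atTop C))
  refine ⟨l₀, fun l hl => ⟨?_, (hl₀ l hl).2⟩⟩
  have h3 := (hl₀ l hl).1
  rw [Real.norm_of_nonneg (by positivity), Real.norm_of_nonneg (by positivity), one_div_mul_eq_div,
    le_div_iff₀ (by positivity)] at h3
  calc C * l ^ 2 ≤ l ^ 2 * (|C| + 1) := by nlinarith [le_abs_self C, sq_nonneg l]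
    _ ≤ _ := h3
    _ = _ := by ring_nf

/-- The estimates that hold between the parameters once `l = log log x` is large. Here `L = log x`
and `ρ = log R`. -/
theorem exists_parameter_bounds {ε A c : ℝ} (hε : 0 < ε) (hc : 0 ≤ c) :
    ∃ l₀ : ℝ, ∀ l L : ℝ, l₀ ≤ l → L = Real.exp l → 8 ≤ l ∧
      A * l ≤ ε * L / (3 * l) ∧ ε * L / (3 * l) ≤ ε * L ∧ ε * L / (3 * l) ≤ L / 8 ∧
      c / (3 * (ε * L / (3 * l))) ≤ 1 / 2 ∧ 32 + 32 * c * Real.exp c ≤ l ∧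
      (3 * (4 * l + 8) + 2) * √(36 * (4 * l + 8)) ≤ Real.exp (l / 8) := by
  -- The constant is a sum of nonnegative terms, among them one for each requirement to be met.
  obtain ⟨l₀, hl₀⟩ := exists_forall_sq_le_exp
    (2736 + 3 * |A| / ε + 2 * c / ε + 8 * ε + 32 * c * Real.exp c)
  refine ⟨l₀, fun l L hl hL => ?_⟩
  obtain ⟨h1, h2⟩ := hl₀ l hl
  have e1 : 0 ≤ 3 * |A| / ε := by positivity
  have e2 : 0 ≤ 2 * c / ε := by positivity
  have e3 : 0 ≤ 32 * c * Real.exp c := by positivity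
  have hl8 : 8 ≤ l := by linarith
  have hl0 : 0 < l := by linarith
  have hLexp : Real.exp (l / 8) ≤ L := by rw [hL]; gcongr; linarith
  have hL0 : 0 < L := by rw [hL]; positivity
  have hsq : 0 < l ^ 2 := by positivity
  have hll : l ≤ l ^ 2 := by nlinarith
  refine ⟨hl8, ?_, ?_, ?_, ?_, by linarith, ?_⟩
  · rw [le_div_iff₀ (by positivity)]
    have : 3 * |A| / ε * l ^ 2 ≤ L := by nlinarith
    rw [div_mul_eq_mul_div, div_le_iff₀ hε] at this
    nlinarith [le_abs_self A]
  · exact div_le_self (by positivity) (by linarith)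
  · rw [div_le_div_iff₀ (by positivity) (by norm_num)]
    nlinarith
  · have h3 : 3 * (ε * L / (3 * l)) = ε * L / l := by field_simp
    rw [h3, div_le_iff₀ (by positivity)]
    have : 2 * c / ε * l ≤ L := by nlinarith
    rw [div_mul_eq_mul_div, div_le_iff₀ hε] at this
    rw [mul_div_assoc', le_div_iff₀ hl0]
    linarith
  · have h3 : √(36 * (4 * l + 8)) ≤ 6 * (4 * l + 8) := by
      rw [Real.sqrt_le_left (by positivity)]
      nlinarith
    calc _ ≤ (3 * (4 * l + 8) + 2) * (6 * (4 * l + 8)) := by gcongr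
      -- `12l + 26 ≤ 38l`, `24l + 48 ≤ 72l` and `38 · 72 = 2736`.
      _ ≤ 2736 * l ^ 2 := by nlinarith
      _ ≤ Real.exp (l / 8) := by nlinarith

/-- Since `3ρ = εL/l`, Rankin's factor is `exp(-cl/(4ε)) = exp(-(H+17)l)`. The Euler product costs
at most `exp(17l)`: `16l` from the double logarithm and `l` for the constants. -/
theorem sum_inv_smooth_le_exp_neg {H c ε l L ρ : ℝ} (hε : 0 < ε) (hc : c = 4 * ε * (H + 17))
    (hH : 0 ≤ H) (hl : 8 ≤ l) (hL : L = Real.exp l) (hρ : ρ = ε * L / (3 * l)) (hlρ : l ≤ ρ)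
    (hρL : ρ ≤ L / 8) (hcρ : c / (3 * ρ) ≤ 1 / 2) (hcl : 32 + 32 * c * Real.exp c ≤ l)
    (T : Finset ℕ) (hT : ∀ d ∈ T, Real.exp (L / 4) ≤ d ∧
      ∀ p : ℕ, p.Prime → p ∣ d → (p : ℝ) ≤ Real.exp (3 * ρ)) :
    ∑ d ∈ T, (1 : ℝ) / d ≤ Real.exp (-(H * l)) := by
  have hL0 : 0 < L := by rw [hL]; positivity
  have hc0 : 0 ≤ c := by rw [hc]; positivity
  have h := sum_inv_smooth_le (z := Real.exp (3 * ρ)) (c := c) (D := Real.exp (L / 4))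
    (by linarith [Real.add_one_le_exp (3 * ρ)]) hc0 (by positivity)
    (by rwa [Real.log_exp]) T hT
  refine h.trans ?_
  rw [Real.log_exp, ← Real.exp_mul, ← Real.exp_add]
  gcongr
  have h1 : L / 4 * -(c / (3 * ρ)) = -((H + 17) * l) := by
    rw [hρ, hc]
    field_simp
  have h2 : Real.log (3 * ρ) ≤ l := by
    rw [Real.log_le_iff_le_exp (by linarith), ← hL]; linarith
  rw [h1]
  linarith

theorem sqrt_exp (t : ℝ) : √(Real.exp t) = Real.exp (t / 2) := by
  rw [Real.sqrt_eq_rpow, ← Real.exp_mul]; ring_nf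

/-- The case of large `x`, with all quantities written as exponentials. -/
theorem exists_exceptional_set_of_large {ε γ B : ℝ} (hε : 0 < ε) (hγ : 0 < γ)
    (hγε : γ ≤ 1 / 2 - ε) (hB : 0 ≤ B) :
    ∃ l₀ : ℝ, ∀ l L ρ : ℝ, l₀ ≤ l → L = Real.exp l → ρ = ε * L / (3 * l) →
      ∀ f : ArithmeticFunction ℂ, f.IsMultiplicative → (∀ n, ‖f n‖ ≤ 1) →
      SupportedOnSmooth f (Real.exp (γ * L)) →
      ∃ Ξ : Finset ModChar,
        (∀ ψ ∈ Ξ, 1 ≤ ψ.1 ∧ (ψ.1 : ℝ) ≤ Real.exp ρ ∧ ψ.2.IsPrimitive) ∧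
        (Ξ.card : ℝ) ≤ 4 * Real.exp ((6 * B + 13 / 2) * l) ∧
        ∀ (q : ℕ) [NeZero q], (q : ℝ) ≤ Real.exp ρ → ∀ a : ℤ, IsCoprime a (q : ℤ) →
          (q.totient : ℝ) * ‖discrepancy Ξ f (Real.exp L) q a‖ ≤
            82 * Real.exp (L - B * l) := by
  -- The solution of `-H + (3B + 13/4) = -B`, where `3B + 13/4` is the exponent of `√|Ξ|`.
  set H := 4 * B + 13 / 4 with hH
  set c := 4 * ε * (H + 17) with hc
  have hH0 : 0 ≤ H := by rw [hH]; positivity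
  -- `6B + 11/2` is the power of `L` lost in `δ²η/L`; the large-value condition `R² ≤ δ²ηz/L` with
  -- `z = R³` needs `R` to exceed it.
  obtain ⟨l₀, hl₀⟩ := exists_parameter_bounds (A := 6 * B + 11 / 2) (c := c) hε
    (by rw [hc]; positivity)
  refine ⟨l₀, fun l L ρ hl hL hρ f hmul hf hsupp => ?_⟩
  obtain ⟨hl8, hAρ, hρε, hρ8, hcρ, hcl, hpoly⟩ := hl₀ l L hl hL
  rw [← hρ] at hAρ hρε hρ8 hcρ
  have hBl : 0 ≤ B * l := by positivity
  have hlρ : l ≤ ρ := by nlinarith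
  have hHl : H * l = 4 * (B * l) + 13 / 4 * l := by rw [hH]; ring
  have hAl : 6 * (B * l) + 11 / 2 * l ≤ ρ := by linarith
  have hL0 : 0 < L := by rw [hL]; positivity
  have hL9 : 9 ≤ L := by rw [hL]; linarith [Real.add_one_le_exp l]
  have hγL : γ * L ≤ L / 2 - ε * L := by nlinarith
  have hγL0 : 0 < γ * L := by positivity
  have hεL0 : 0 < ε * L := by positivity
  have hρ9 : 9 ≤ Real.exp ρ := by linarith [Real.add_one_le_exp ρ]
  set x := Real.exp L with hx
  set y := Real.exp (γ * L) with hy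
  set z := Real.exp (3 * ρ) with hz
  set η := Real.exp (-(H * l)) with hη
  -- `5/8 = 1/2 + 1/8`: the first part pays for `√L`, the second for the polynomial in `l`.
  set δ := Real.exp (-((B + 5 / 8) * l)) with hδ
  have hx0 : 0 < x := Real.exp_pos _
  have hz0 : 0 < z := Real.exp_pos _
  have hη0 : 0 < η := Real.exp_pos _
  have hδ0 : 0 < δ := Real.exp_pos _
  have hη1 : η ≤ 1 := by rw [hη, Real.exp_le_one_iff]; linarith
  have hηz : Real.exp ρ ≤ η * z := by
    rw [hη, hz, ← Real.exp_add, Real.exp_le_exp]; linarith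
  have hηx : Real.exp (L / 2 + ρ) ≤ η * x := by
    rw [hη, hx, ← Real.exp_add, Real.exp_le_exp]; linarith
  have hlog : Real.log (y / z) ≤ L := by
    rw [Real.log_div (Real.exp_pos _).ne' hz0.ne', Real.log_exp, Real.log_exp]; linarith
  have hδsq : δ ^ 2 = Real.exp (-((2 * B + 5 / 4) * l)) := by
    rw [hδ, ← Real.exp_nat_mul]; push_cast; ring_nf
  have hR : Real.exp ρ ^ 2 ≤ δ ^ 2 * (η * z / L) := by
    rw [hδsq, hη, hz, hL, ← Real.exp_add, ← Real.exp_sub, ← Real.exp_add, ← Real.exp_nat_mul,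
      Real.exp_le_exp]
    push_cast
    linarith
  have hcard : ((exceptionalChars f z y η δ L (Real.exp ρ)).card : ℝ) ≤
      4 * Real.exp ((6 * B + 13 / 2) * l) := by
    refine (card_exceptionalChars_le hf hz0 hη0 hη1 hδ0 (by linarith) (by linarith) hR).trans
      (le_of_eq ?_)
    rw [mul_div_assoc, hδsq, hη, hL, ← Real.exp_nat_mul, ← Real.exp_add, ← Real.exp_sub]
    congr 2
    push_cast
    linarith
  have hirr : ∀ (q : ℕ) [NeZero q], (q : ℝ) ≤ Real.exp ρ → ∀ c : ZMod q, IsUnit c →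
      (((irregularSet x y z η).filter fun m : ℕ => (m : ZMod q) = c).card : ℝ) ≤
        9 * (η * x / q) := by
    intro q _ hq b hb
    refine card_irregularSet_residue_class_le (D := Real.exp (L / 4)) hη0 hx0
      (Real.one_le_exp hγL0.le) (Real.one_le_exp (by linarith)) (Real.one_le_exp (by linarith))
      ?_ ?_ ?_ ?_ ?_ b hb
    · calc y * q ≤ y * Real.exp ρ := by gcongr
        _ = Real.exp (γ * L + ρ) := by rw [hy, ← Real.exp_add]
        _ ≤ Real.exp (L / 2 + ρ) := by gcongr; linarith
        _ ≤ _ := hηx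
    · rw [div_le_iff₀ hz0]; linarith
    · calc Real.exp (L / 4) * z * q ≤ Real.exp (L / 4) * z * Real.exp ρ := by gcongr
        _ = Real.exp (L / 4 + 3 * ρ + ρ) := by rw [hz, ← Real.exp_add, ← Real.exp_add]
        _ ≤ x := by rw [hx]; gcongr; linarith
    · rw [hη, hx, ← Real.exp_add, ← Real.exp_add, Real.exp_le_exp]
      linarith
    · exact sum_inv_smooth_le_exp_neg hε hc hH0 hl8 hL hρ hlρ hρ8 hcρ hcl
  have hirr1 : ((irregularSet x y z η).card : ℝ) ≤ 9 * (η * x) := by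
    have h := hirr 1 (by push_cast; linarith) 1 isUnit_one
    rw [Finset.filter_true_of_mem fun n _ => Subsingleton.elim _ _] at h
    simpa using h
  refine ⟨exceptionalChars f z y η δ L (Real.exp ρ), fun ψ hψ => ?_, hcard, fun q _ hq a ha => ?_⟩
  · obtain ⟨i, _, hi⟩ := mem_exceptionalChars.1 hψ
    have := mem_cellExceptional.1 hi
    exact ⟨this.1.1, this.1.2, this.2.1⟩
  · have hmain := totient_mul_norm_discrepancy_le hmul hf hx0 hz0 hη0 hsupp
      (by positivity) hirr1 (fun b hb => by rw [mul_div_assoc]; exact hirr q hq b hb)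
      (exceptionalChars f z y η δ L (Real.exp ρ)) a ha
    have hbil := sum_norm_pairCoeff_char_le hf hx0 hz0 hη0 hη1 hδ0.le (by linarith) hlog hq
      -- Here `γ ≤ 1/2 - ε` is decisive: `y² ≤ x^(1-2ε)`, while `9q ≤ R² ≤ x^(2ε)`.
      (hq.trans hηz) (by
        calc (q : ℝ) * (9 * y ^ 2) ≤ Real.exp ρ * (Real.exp ρ * y ^ 2) := by gcongr
          _ = Real.exp (ρ + (ρ + 2 * (γ * L))) := by
              rw [hy, ← Real.exp_nat_mul, ← Real.exp_add, ← Real.exp_add]; push_cast; rfl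
          _ ≤ x := by rw [hx]; gcongr; linarith)
    have hyx : y ≤ x := by rw [hy, hx]; gcongr; linarith
    have hSg : ∑ p ∈ primesIoc z y, (1 : ℝ) / p ≤ 4 * l + 8 := by
      have := sum_prime_inv_le (z := x) (by linarith [Real.add_one_le_exp L]) (primesIoc z y)
        (fun p hp => (mem_primesIoc.1 hp).1) (fun p hp => (mem_primesIoc.1 hp).2.2.trans hyx)
      rwa [hx, Real.log_exp, hL, Real.log_exp] at this
    have hb2 : x * (δ * (3 * ∑ p ∈ primesIoc z y, (1 : ℝ) / p + 2)) *
        √(36 * L * ∑ p ∈ primesIoc z y, (1 : ℝ) / p) ≤ Real.exp (L - B * l) := by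
      calc _ ≤ x * (δ * (3 * (4 * l + 8) + 2)) * √(L * (36 * (4 * l + 8))) := by
            gcongr x * (δ * (3 * ?_ + 2)) * √?_
            calc _ = L * (36 * ∑ p ∈ primesIoc z y, (1 : ℝ) / p) := by ring
              _ ≤ _ := by gcongr
        _ = x * δ * √L * ((3 * (4 * l + 8) + 2) * √(36 * (4 * l + 8))) := by
            rw [Real.sqrt_mul hL0.le]; ring
        _ ≤ x * δ * √L * Real.exp (l / 8) := by gcongr
        _ = _ := by
            rw [hx, hδ, hL, sqrt_exp, ← hL, ← Real.exp_add, ← Real.exp_add, ← Real.exp_add]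
            congr 1
            ring
    have hrest : 3 * (9 * (η * x)) *
        (1 + √((exceptionalChars f z y η δ L (Real.exp ρ)).card : ℝ)) ≤
        81 * Real.exp (L - B * l) := by
      have h1 : √((exceptionalChars f z y η δ L (Real.exp ρ)).card : ℝ) ≤
          2 * Real.exp ((3 * B + 13 / 4) * l) := by
        rw [Real.sqrt_le_left (by positivity)]
        refine hcard.trans (le_of_eq ?_)
        rw [mul_pow, ← Real.exp_nat_mul]
        push_cast
        ring_nf
      have h2 : 1 ≤ Real.exp ((3 * B + 13 / 4) * l) := Real.one_le_exp (by positivity)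
      calc _ ≤ 3 * (9 * (η * x)) * (Real.exp ((3 * B + 13 / 4) * l) +
            2 * Real.exp ((3 * B + 13 / 4) * l)) := by gcongr
        _ = 81 * (η * x * Real.exp ((3 * B + 13 / 4) * l)) := by ring
        _ = 81 * Real.exp (L - B * l) := by
            rw [hη, hx, ← Real.exp_add, ← Real.exp_add]
            congr 2
            linarith
    linarith

/-! ### Bounded `x` and conclusion -/

theorem norm_discrepancy_empty_le {f : ArithmeticFunction ℂ} (hf : ∀ n, ‖f n‖ ≤ 1) {x : ℝ}
    (hx : 0 ≤ x) (q : ℕ) [NeZero q] (a : ℤ) : ‖discrepancy ∅ f x q a‖ ≤ x := by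
  classical
  have h : inducedChars ∅ q = ∅ := by
    unfold inducedChars
    exact Finset.filter_eq_empty_iff.2 fun χ _ ⟨ψ, hψ, _⟩ => by simp at hψ
  unfold discrepancy
  rw [h, Finset.sum_empty, mul_zero, sub_zero]
  calc _ ≤ ∑ n ∈ (Finset.Icc 1 ⌊x⌋₊).filter (fun n : ℕ => (n : ℤ) ≡ a [ZMOD q]), (1 : ℝ) :=
        norm_sum_le_of_le _ fun n _ => hf n
    _ ≤ ∑ n ∈ Finset.Icc 1 ⌊x⌋₊, (1 : ℝ) :=
        Finset.sum_le_sum_of_subset_of_nonneg (Finset.filter_subset _ _) fun _ _ _ => zero_le_one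
    _ = ⌊x⌋₊ := by simp
    _ ≤ x := Nat.floor_le hx

theorem log_log_three_pos : 0 < Real.log (Real.log 3) := by
  refine Real.log_pos ?_
  rw [Real.lt_log_iff_exp_lt (by norm_num)]
  exact Real.exp_one_lt_three

theorem proposition1p3 (ε γ B : ℝ) (hε : 0 < ε) (hγ : 0 < γ) (hγε : γ ≤ 1 / 2 - ε) (hB : 0 ≤ B) :
    ∃ (C₁ C₂ : ℝ) (o : ℝ → ℝ), Tendsto o atTop (𝓝 0) ∧
      ∀ x : ℝ, 3 ≤ x →
      ∀ f : ArithmeticFunction ℂ, InClassC f → SupportedOnSmooth f (x ^ γ) →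
      ∃ Ξ : Finset ModChar,
        (∀ ψ ∈ Ξ, 1 ≤ ψ.1 ∧ (ψ.1 : ℝ) ≤ x ^ (ε / (3 * Real.log (Real.log x))) ∧
          ψ.2.IsPrimitive) ∧
        (Ξ.card : ℝ) ≤ C₁ * Real.log x ^ (6 * B + 7 + o x) ∧
        ∀ (q : ℕ) [NeZero q], (q : ℝ) ≤ x ^ (ε / (3 * Real.log (Real.log x))) →
          ∀ a : ℤ, IsCoprime a (q : ℤ) →
            ‖discrepancy Ξ f x q a‖ ≤
              C₂ * (1 / (Nat.totient q : ℝ)) * (x / Real.log x ^ B) := by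
  obtain ⟨l₀, hl₀⟩ := exists_exceptional_set_of_large hε hγ hγε hB
  -- For `l < l₀` both `q ≤ R` and `log x` are bounded; `K` dominates `φ(q) (log x)^B`, so the empty
  -- set and the trivial bound suffice.
  set K := Real.exp (ε * Real.exp l₀ / (3 * Real.log (Real.log 3))) * Real.exp l₀ ^ B with hK
  have hK0 : 0 ≤ K := by positivity
  -- The exponent `6B + 13/2` obtained for large `x` is below `6B + 7`, so `o = 0` is admissible.
  refine ⟨4, 82 + K, fun _ => 0, tendsto_const_nhds, fun x hx f hf hsupp => ?_⟩
  have hx0 : 0 < x := by linarith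
  have hll3 := log_log_three_pos
  have hlog3 : 0 < Real.log 3 := Real.log_pos (by norm_num)
  set L := Real.log x with hL
  set l := Real.log L with hl
  have hL3 : Real.log 3 ≤ L := Real.log_le_log (by norm_num) hx
  have hl3 : Real.log (Real.log 3) ≤ l := Real.log_le_log hlog3 hL3
  have hL0 : 0 < L := by linarith
  have hl0 : 0 < l := by linarith
  have hxL : x = Real.exp L := (Real.exp_log hx0).symm
  have hLl : L = Real.exp l := (Real.exp_log hL0).symm
  have hLpow : ∀ t : ℝ, L ^ t = Real.exp (t * l) := fun t => by
    rw [Real.rpow_def_of_pos hL0, mul_comm]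
  have hxpow : ∀ t : ℝ, x ^ t = Real.exp (t * L) := fun t => by
    rw [Real.rpow_def_of_pos hx0, mul_comm]
  have hR : x ^ (ε / (3 * l)) = Real.exp (ε * L / (3 * l)) := by
    rw [hxpow]; congr 1; ring
  rcases le_or_gt l₀ l with h | h
  · obtain ⟨Ξ, h1, h2, h3⟩ := hl₀ l L _ h hLl rfl f hf.1 hf.norm_le_one (by rwa [← hxpow])
    refine ⟨Ξ, by rwa [hR], ?_, fun q _ hq a ha => ?_⟩
    · refine h2.trans ?_
      rw [hLpow]
      simp only [add_zero]
      gcongr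
      norm_num
    · rw [hR] at hq
      have hφ : (0 : ℝ) < q.totient := by
        exact_mod_cast Nat.totient_pos.2 (Nat.pos_of_ne_zero (NeZero.ne q))
      have h4 := h3 q hq a ha
      rw [← hxL, Real.exp_sub, ← hxL, ← hLpow] at h4
      have h5 : 0 ≤ x / L ^ B := by positivity
      rw [mul_one_div, div_mul_eq_mul_div, le_div_iff₀ hφ, mul_comm]
      refine h4.trans ?_
      gcongr
      linarith
  · refine ⟨∅, by simp, by simp; positivity, fun q _ hq a _ => ?_⟩
    have hφ : (0 : ℝ) < q.totient := by
      exact_mod_cast Nat.totient_pos.2 (Nat.pos_of_ne_zero (NeZero.ne q))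
    refine (norm_discrepancy_empty_le hf.norm_le_one hx0.le q a).trans ?_
    have hLle : L ≤ Real.exp l₀ := by rw [hLl]; gcongr
    have hφle : (q.totient : ℝ) ≤ Real.exp (ε * Real.exp l₀ / (3 * Real.log (Real.log 3))) := by
      calc (q.totient : ℝ) ≤ q := by exact_mod_cast Nat.totient_le q
        _ ≤ Real.exp (ε * L / (3 * l)) := by rwa [← hR]
        _ ≤ _ := by gcongr
    have hmul : q.totient * L ^ B ≤ 82 + K := by
      have : q.totient * L ^ B ≤ K := by rw [hK]; gcongr
      linarith
    have hLB : 0 < L ^ B := by positivity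
    rw [mul_one_div, div_mul_div_comm, le_div_iff₀ (by positivity)]
    nlinarith
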